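/- **Setting.** A Markov chain $x_0,x_1,\dots$ on $\mathbb X=\{1,\dots,X\}$ has transition matrix $A$ and initial distribution $\pi\in\Pi(X)$, the unit simplex. A measurement of state $x$ has density $B_{x\cdot}$ with respect to a $\sigma$-finite measure $\nu$ on $\mathbb R$ (e.g. Lebesgue or counting measure); write $\sum_y$ for integration against $\nu$. The actions are $u\in\{0,1,\dots,L\}$; $u=0$ means "stop", and $u\ge 1$ means "take the next measurement after $D_u$ time points", where $D_1,\dots,D_L$ are distinct positive integers. The costs $c(i,u)\ge0$ and $m(i,u)\ge 0$ are given. The first decision is taken at $\tau_1=0$ in the belief $\pi_1=\pi$; if $u_k\neq0$, then $\tau_{k+1}=\tau_k+D_{u_k}$, a measurement $y_{k+1}$ of $x_{\tau_{k+1}}$ is taken, and $\pi_{k+1}=T(\pi_k,y_{k+1},u_k)$, where $$T(\pi,y,u)=\frac{B_y (A')^{D_u}\pi}{\sigma(\pi,y,u)},\qquad \sigma(\pi,y,u)=\mathbf 1'B_y(A')^{D_u}\pi,\qquad B_y=\mathrm{diag}(B_{1y},\dots,B_{Xy}).$$ A stationary strategy is a measurable map $\mu:\Pi(X)\to\{0,\dots,L\}$,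 with $u_k=\mu(\pi_k)$. With $k^*=\inf\{k:u_k=0\}$, its expected total cost in the model $\theta=(A,B)$ is $$J_\mu(\pi;\theta)=\mathbb E\Big\{\sum_{k=1}^{k^*-1}\Big[m(x_{\tau_k},u_k)+\sum_{t=\tau_k}^{\tau_{k+1}-1}c(x_t,u_k)\Big]+c(x_{\tau_{k^*}},0)\Big\}$$ (without the last term if $k^*=\infty$). Let $V(\pi;\theta)=\inf_\mu J_\mu(\pi;\theta)$; a strategy $\mu$ is optimal if $J_{\mu}(\pi;\theta)=V(\pi;\theta)$ for all $\pi$. Let $C_0=(c(i,0))_i$ and, for $u\ge1$, $C_u=m_u+(I+A+\dots+A^{D_u-1})c_u$, where $m_u=(m(i,u))_i$ and $c_u=(c(i,u))_i$. A matrix or kernel $M$ is TP2 if $M_{ij'}M_{i'j}\le M_{ij}M_{i'j'}$ for all $i<i'$ and $j<j'$. **Theorem.** Let $\theta=(A,B)$ and $\bar\theta=(\bar A,\bar B)$ be two models with the same $D$, $c$ and $m$. Assume: * $A\succeq\bar A$, that is, $A_{ij}\bar A_{mk}\le\bar A_{ij}A_{mk}$ for all $i,m$ and all $j<k$. (If no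 column other than the first and the last vanishes in both matrices, it is equivalent to require this for $k=j+1$ only.) * $B=\bar B R$ for some stochastic kernel $R$; so $\bar B$ gives the more accurate measurements. * (A1) (i) For each $u\in\{0,\dots,L\}$, both $C_u$ (for $\theta$) and $c_u$ have non-decreasing entries. (ii) State $1$ belongs to the stopping set of $\theta$: for each $u\ge1$, $C_0'e_1\le C_u'e_1+\sum_y V(T(e_1,y,u);\theta)\,\sigma(e_1,y,u)$. * (A2) $A$ is TP2. * (A3) $B$ is TP2. Then both models have optimal stationary strategies, and any optimal strategies $\mu^*(\theta)$ and $\mu^*(\bar\theta)$ satisfy $$J_{\mu^*(\theta)}(\pi;\theta)\ \ge\ J_{\mu^*(\bar\theta)}(\pi;\bar\theta)\qquad\text{for all }\pi\in\Pi(X).$$ -/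

import Mathlib

open MeasureTheory ProbabilityTheory
open scoped ENNReal NNReal Matrix

/-! ### Stochastic orders and total positivity -/

/-- Total positivity of order two: all second order minors are non-negative. -/
def IsTP2 {ι κ : Type*} [LT ι] [LT κ] (M : ι → κ → ℝ) : Prop :=
  ∀ i i' : ι, i < i' → ∀ j j' : κ, j < j' → M i j' * M i' j ≤ M i j * M i' j'

/-- The ordering `A ⪰ A'` of transition matrices:
`A i j * A' m k ≤ A' i j * A m k` for all rows `i, m` and all columns `j < k`. -/
def TransitionDominates {X : ℕ} (A A' : Matrix (Fin X) (Fin X) ℝ) : Prop :=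
  ∀ i m j k : Fin X, j < k → A i j * A' m k ≤ A' i j * A m k

/-- It suffices to check the inequalities of `TransitionDominates` on consecutive columns
`k = j + 1`, as soon as no column other than the first and the last one vanishes identically in
both matrices. -/
theorem transitionDominates_iff_consecutive {X : ℕ} {A A' : Matrix (Fin X) (Fin X) ℝ}
    (hA : ∀ i j, 0 ≤ A i j) (hA' : ∀ i j, 0 ≤ A' i j)
    (hcol : ∀ j : Fin X, 0 < (j : ℕ) → (j : ℕ) + 1 < X → ∃ r, 0 < A r j ∨ 0 < A' r j) :
    TransitionDominates A A' ↔
      ∀ i m j k : Fin X, (k : ℕ) = (j : ℕ) + 1 → A i j * A' m k ≤ A' i j * A m k := by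
  constructor
  · intro h i m j k hjk
    exact h i m j k (Fin.lt_def.2 (by omega))
  · intro h
    have key : ∀ d : ℕ, ∀ i m j k : Fin X, (k : ℕ) = (j : ℕ) + 1 + d →
        A i j * A' m k ≤ A' i j * A m k := by
      intro d
      induction d with
      | zero => intro i m j k hjk; exact h i m j k (by omega)
      | succ d ih =>
        intro i m j k hjk
        have hk := k.isLt
        let l : Fin X := ⟨(j : ℕ) + 1 + d, by omega⟩
        have h1 : ∀ r, A i j * A' r l ≤ A' i j * A r l := fun r => ih i r j l rfl
        have h2 : ∀ r, A r l * A' m k ≤ A' r l * A m k := fun r => h r m l k (by simp only [l]; omega)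
        obtain ⟨r, hr⟩ := hcol l (by simp only [l]; omega) (by simp only [l]; omega)
        have e1 := h1 r
        have e2 := h2 r
        have p1 := hA i j
        have p2 := hA' i j
        have p3 := hA m k
        have p4 := hA' m k
        have p5 := hA r l
        have p6 := hA' r l
        have p0 : 0 ≤ A' i j * A m k := mul_nonneg p2 p3
        rcases p5.lt_or_eq with q5 | q5
        · rcases p6.lt_or_eq with q6 | q6
          · have e3 : (A i j * A' r l) * (A r l * A' m k) ≤
                (A' i j * A r l) * (A' r l * A m k) :=
              mul_le_mul e1 e2 (mul_nonneg p5 p4) (mul_nonneg p2 p5)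
            have q : 0 < A r l * A' r l := mul_pos q5 q6
            refine le_of_mul_le_mul_right ?_ q
            nlinarith [e3]
          · rw [← q6, zero_mul] at e2
            have : A' m k = 0 := by
              by_contra hne
              have : 0 < A' m k := lt_of_le_of_ne p4 (Ne.symm hne)
              nlinarith [mul_pos q5 this]
            rw [this, mul_zero]; exact p0
        · have q6 : 0 < A' r l := by
            rcases hr with hr | hr
            · exact absurd hr (by rw [← q5]; exact lt_irrefl _)
            · exact hr
          rw [← q5, mul_zero] at e1
          have : A i j = 0 := by
            by_contra hne
            have : 0 < A i j := lt_of_le_of_ne p1 (Ne.symm hne)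
            nlinarith [mul_pos this q6]
          rw [this, zero_mul]; exact p0
    intro i m j k hjk
    have := Fin.lt_def.1 hjk
    exact key ((k : ℕ) - (j : ℕ) - 1) i m j k (by omega)

/-! ### The optimal sampling problem -/

/-- The data of an optimal sampling problem with states `Fin X` (the target state is `0`) which do
not depend on the model.  The actions are `Fin (L + 1)`: action `0` is "announce and stop", and
action `u ≠ 0` is "take the next measurement after `D u` time points".  `c x u` is the cost per
time point and `m x u` is the measurement cost; the values `D 0` and `m x 0` are not used. -/
structure SamplingProtocol (X L : ℕ) where
  D : Fin (L + 1) → ℕ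
  D_pos : ∀ u, u ≠ 0 → 0 < D u
  D_injOn : Set.InjOn D {u | u ≠ 0}
  c : Fin X → Fin (L + 1) → ℝ≥0
  m : Fin X → Fin (L + 1) → ℝ≥0

/-- A model `θ = (A, B)`: a transition matrix `A`, and an observation distribution with
density `B x` given the state `x` with respect to a σ-finite measure `ν` on `ℝ` (for instance the
Lebesgue measure on a subset of `ℝ`, or the counting measure on a set of integers). -/
structure SamplingModel (X : ℕ) where
  A : Matrix (Fin X) (Fin X) ℝ
  A_stochastic : A ∈ Matrix.rowStochastic ℝ (Fin X)
  ν : Measure ℝ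
  sigmaFinite : SigmaFinite ν
  B : Fin X → ℝ → ℝ
  B_nonneg : ∀ x y, 0 ≤ B x y
  B_measurable : ∀ x, Measurable (B x)
  B_lintegral : ∀ x, ∫⁻ y, ENNReal.ofReal (B x y) ∂ν = 1

/-- Belief states: the unit simplex. -/
abbrev Belief (X : ℕ) : Type := stdSimplex ℝ (Fin X)

/-- Stationary strategies: measurable maps from belief states to actions. -/
abbrev SamplingStrategy (X L : ℕ) : Type := {μ : Belief X → Fin (L + 1) // Measurable μ}

namespace SamplingModel

variable {X L : ℕ}

/-- The conditional law of a measurement, given the state `x`. -/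
noncomputable def obsLaw (θ : SamplingModel X) (x : Fin X) : Measure ℝ :=
  θ.ν.withDensity fun y => ENNReal.ofReal (θ.B x y)

instance (θ : SamplingModel X) (x : Fin X) : IsProbabilityMeasure (θ.obsLaw x) :=
  ⟨by rw [obsLaw, withDensity_apply _ MeasurableSet.univ, Measure.restrict_univ, θ.B_lintegral]⟩

/-- The observation distribution of `θ'` is obtained from the one of `θ` by a stochastic kernel
`R`, that is, `B' = B R`: `θ` gives the more accurate measurements. -/
def ReverseBlackwell (θ' θ : SamplingModel X) : Prop :=
  ∃ R : Kernel ℝ ℝ, IsMarkovKernel R ∧ ∀ x, θ'.obsLaw x = (θ.obsLaw x).bind R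

/-! #### The hidden Markov model -/

/-- The joint law of a state with distribution `p` and a measurement of it. -/
noncomputable def jointLaw (θ : SamplingModel X) (p : Fin X → ℝ) : Measure (Fin X × ℝ) :=
  ∑ x, ENNReal.ofReal (p x) • (Measure.dirac x).prod (θ.obsLaw x)

theorem isProbabilityMeasure_jointLaw (θ : SamplingModel X) {p : Fin X → ℝ}
    (hp : p ∈ stdSimplex ℝ (Fin X)) : IsProbabilityMeasure (θ.jointLaw p) := by
  constructor
  simp only [jointLaw, Measure.coe_finsetSum, Finset.sum_apply, Measure.smul_apply, measure_univ,
    smul_eq_mul, mul_one]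
  rw [← ENNReal.ofReal_sum_of_nonneg fun x _ => hp.1 x, hp.2, ENNReal.ofReal_one]

theorem A_row_mem (θ : SamplingModel X) (x : Fin X) : θ.A x ∈ stdSimplex ℝ (Fin X) :=
  ⟨fun j => θ.A_stochastic.1 x j, by
    have h := congrFun θ.A_stochastic.2 x
    simpa [Matrix.mulVec, dotProduct] using h⟩

/-- The transition kernel of (state, measurement): the next state is drawn from the row of `A`
at the present state, and then a measurement of the next state is drawn. -/
noncomputable def step (θ : SamplingModel X) : Kernel (Fin X × ℝ) (Fin X × ℝ) where
  toFun s := θ.jointLaw (θ.A s.1)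
  measurable' := (measurable_of_finite fun x => θ.jointLaw (θ.A x)).comp measurable_fst

instance (θ : SamplingModel X) : IsMarkovKernel θ.step :=
  ⟨fun s => θ.isProbabilityMeasure_jointLaw (θ.A_row_mem s.1)⟩

/-- The law of the trajectory `(x_t, z_t)`, `t = 0, 1, …`, where `x` is the Markov chain with
initial distribution `π` and transition matrix `A`, and `z_t` is the measurement of `x_t` (which
the decision maker gets to see only if `t` is one of the sampling times). -/
noncomputable def pathLaw (θ : SamplingModel X) (π : Belief X) : Measure (ℕ → Fin X × ℝ) :=
  Kernel.trajMeasure (X := fun _ => Fin X × ℝ) (θ.jointLaw π)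
    fun n => θ.step.comap (fun h => h ⟨n, Finset.mem_Iic.2 le_rfl⟩) (measurable_pi_apply _)

/-! #### The Bayesian filter -/

/-- The predicted distribution `(A')^{D_u} π` of the state at the next sampling time. -/
noncomputable def predict (θ : SamplingModel X) (P : SamplingProtocol X L) (π : Belief X)
    (u : Fin (L + 1)) : Fin X → ℝ :=
  (θ.A ^ P.D u)ᵀ *ᵥ π.1

/-- The normalization `σ(π, y, u)`. -/
noncomputable def sigma (θ : SamplingModel X) (P : SamplingProtocol X L) (π : Belief X) (y : ℝ)
    (u : Fin (L + 1)) : ℝ :=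
  ∑ x, θ.B x y * θ.predict P π u x

theorem predict_nonneg (θ : SamplingModel X) (P : SamplingProtocol X L) (π : Belief X)
    (u : Fin (L + 1)) (x : Fin X) : 0 ≤ θ.predict P π u x := by
  have h : 0 ≤ ∑ j, (θ.A ^ P.D u) j x * π.1 j := Finset.sum_nonneg fun j _ =>
    mul_nonneg ((pow_mem θ.A_stochastic (P.D u)).1 j x) (π.2.1 j)
  exact h

/-- The Bayesian update `T(π, y, u)`.  It is given the value `π` where the normalization is zero,
which is an event of probability zero. -/
noncomputable def filter (θ : SamplingModel X) (P : SamplingProtocol X L) (π : Belief X) (y : ℝ)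
    (u : Fin (L + 1)) : Belief X :=
  if h : 0 < θ.sigma P π y u then
    ⟨fun x => θ.B x y * θ.predict P π u x / θ.sigma P π y u,
      fun x => div_nonneg (mul_nonneg (θ.B_nonneg x y) (θ.predict_nonneg P π u x)) h.le,
      by rw [← Finset.sum_div]; exact div_self h.ne'⟩
  else π

/-! #### Costs -/

/-- The cost vector `C_u`: `C_0 = c_0`, and `C_u = m_u + (I + A + ⋯ + A^{D_u - 1}) c_u` for
`u ≠ 0`.  Its `i`-th entry is `C(e_i, u)`. -/
noncomputable def costVec (θ : SamplingModel X) (P : SamplingProtocol X L) (u : Fin (L + 1)) :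
    Fin X → ℝ :=
  if u = 0 then fun i => (P.c i 0 : ℝ)
  else (fun i => (P.m i u : ℝ)) +
    (∑ l ∈ Finset.range (P.D u), θ.A ^ l) *ᵥ fun i => (P.c i u : ℝ)

/-- `C(π, u) = C_u' π`. -/
noncomputable def cost (θ : SamplingModel X) (P : SamplingProtocol X L) (π : Belief X)
    (u : Fin (L + 1)) : ℝ :=
  ∑ i, θ.costVec P u i * π.1 i

/-- Sampling times and belief states along the trajectory `ω` under the strategy `μ`: the `k`-th
entry is the `k`-th sampling time together with the belief state there.  The first decision is
taken at time `0` in the belief state `π`.  (Entries after the decision to stop are not used.) -/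
noncomputable def epoch (θ : SamplingModel X) (P : SamplingProtocol X L)
    (μ : SamplingStrategy X L) (π : Belief X) (ω : ℕ → Fin X × ℝ) : ℕ → ℕ × Belief X
  | 0 => (0, π)
  | k + 1 =>
    let s := θ.epoch P μ π ω k
    let t := s.1 + P.D (μ.1 s.2)
    (t, θ.filter P s.2 (ω t).2 (μ.1 s.2))

open Classical in
/-- The cost incurred at and after the `k`-th decision, until the next one, along the trajectory
`ω`: zero if the decision maker has stopped before, the stopping cost if the `k`-th decision is to
stop, and otherwise the measurement cost plus the costs at the time points up to the next sampling
time. -/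
noncomputable def epochCost (θ : SamplingModel X) (P : SamplingProtocol X L)
    (μ : SamplingStrategy X L) (π : Belief X) (ω : ℕ → Fin X × ℝ) (k : ℕ) : ℝ≥0 :=
  if ∃ j < k, μ.1 (θ.epoch P μ π ω j).2 = 0 then 0
  else
    let τ := (θ.epoch P μ π ω k).1
    let u := μ.1 (θ.epoch P μ π ω k).2
    if u = 0 then P.c (ω τ).1 0
    else P.m (ω τ).1 u + ∑ t ∈ Finset.Ico τ (τ + P.D u), P.c (ω t).1 u

/-- The expected total cost `J_μ(π)`. -/
noncomputable def totalCost (θ : SamplingModel X) (P : SamplingProtocol X L)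
    (μ : SamplingStrategy X L) (π : Belief X) : ℝ≥0∞ :=
  ∫⁻ ω, ∑' k, (θ.epochCost P μ π ω k : ℝ≥0∞) ∂θ.pathLaw π

/-- The optimal cost `V(π)`: the infimum of `J_μ(π)` over the stationary strategies `μ`. -/
noncomputable def optimalCost (θ : SamplingModel X) (P : SamplingProtocol X L) (π : Belief X) :
    ℝ≥0∞ :=
  ⨅ μ : SamplingStrategy X L, θ.totalCost P μ π

/-- An optimal strategy attains the infimum at every belief state. -/
def IsOptimal (θ : SamplingModel X) (P : SamplingProtocol X L) (μ : SamplingStrategy X L) : Prop :=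
  ∀ π, θ.totalCost P μ π = θ.optimalCost P π

/-- `Q(π, u)`, the right-hand side of Bellman's equation. -/
noncomputable def bellmanQ (θ : SamplingModel X) (P : SamplingProtocol X L) (π : Belief X)
    (u : Fin (L + 1)) : ℝ≥0∞ :=
  if u = 0 then ENNReal.ofReal (θ.cost P π 0)
  else ENNReal.ofReal (θ.cost P π u) +
    ∫⁻ y, θ.optimalCost P (θ.filter P π y u) * ENNReal.ofReal (θ.sigma P π y u) ∂θ.ν

/-- The stopping set: the belief states in which it is optimal to stop. -/
def stoppingSet (θ : SamplingModel X) (P : SamplingProtocol X L) : Set (Belief X) :=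
  {π | ∀ u, u ≠ 0 → θ.bellmanQ P π 0 ≤ θ.bellmanQ P π u}

end SamplingModel

/-! Value functions are extended from beliefs to arbitrary vectors of masses `p` as positively
homogeneous functions `F`. The normalisation of the filter then cancels: a continuation value times
`σ` is `F (B_y (A')^{D_u} π)`. One step of value iteration becomes a minimum over `u` of a linear
term plus the integral over `y` of `F (B_y (A')^{D_u} p)`. It preserves superadditivity, hence
concavity, in every model. In the model `θ`, where costs are monotone and `A` and `B` are TP2, it
also preserves monotonicity in the likelihood ratio order (`lrMonotone_observe`).

With these two properties of the iterates of `θ`, the models are compared by induction on the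
horizon (`iterValue_le_iterValue`). Coarser measurements raise the average of a concave function, by
Jensen's inequality for the posterior kernel (`observe_le_of_reverseBlackwell`). The dominating
matrix moves the prediction upwards in the likelihood ratio order
(`LRLe.transpose_pow_of_transitionDominates`), which raises both the cost vectors and the averaged
continuation value. No monotonicity of the values of `θ'` is needed.

It remains to identify the limit of value iteration with the infimum of the pathwise costs.
Splitting the trajectory law by initial state and using the Markov property at sampling times gives
Bellman's recursion for the cost of the first `N` decisions under a strategy (`horizonCost_succ`).
Costs are non-negative, so the iterates from `0` increase. By monotone convergence and finiteness of
the action set, a greedy action satisfies Bellman's inequality for the limit, and a measurable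
greedy strategy attains it (`optimalCost_eq_limitValue`). -/

/-! ### The monotone likelihood ratio order -/

/-- The monotone likelihood ratio order on vectors of masses: `q` is dominated by `p`. -/
def LRLe {X : ℕ} (q p : Fin X → ℝ) : Prop :=
  ∀ j k : Fin X, j < k → p j * q k ≤ q j * p k

/-- Symmetrisation device: the term at `(i, m)` is judged together with the one at `(m, i)`. In the
applications the pair factors into two differences of equal sign. -/
theorem sum_sum_nonneg_of_add_swap {ι : Type*} [Fintype ι] {t : ι → ι → ℝ}
    (h : ∀ i m, 0 ≤ t i m + t m i) : 0 ≤ ∑ i, ∑ m, t i m := by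
  have h1 : 0 ≤ ∑ i, ∑ m, (t i m + t m i) :=
    Finset.sum_nonneg fun i _ => Finset.sum_nonneg fun m _ => h i m
  simp only [Finset.sum_add_distrib] at h1
  rw [Finset.sum_comm (f := fun i m => t m i)] at h1
  linarith

namespace LRLe

variable {X : ℕ} {p q r : Fin X → ℝ}

theorem refl (p : Fin X → ℝ) : LRLe p p := fun _ _ _ => le_rfl

/-- The likelihood ratio order is transitive when the middle vector is non-zero. -/
theorem trans (hp : 0 ≤ p) (hq : 0 ≤ q) (hr : 0 ≤ r) (hq0 : q ≠ 0)
    (hrq : LRLe r q) (hqp : LRLe q p) : LRLe r p := by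
  intro j k hjk
  obtain ⟨a, ha⟩ := Function.ne_iff.1 hq0
  have ha : 0 < q a := lt_of_le_of_ne (hq a) (Ne.symm ha)
  have pj := hp j
  have pk := hp k
  have rj := hr j
  have rk := hr k
  simp only [Pi.zero_apply] at pj pk rj rk
  rcases pj.eq_or_lt with pj0 | pj0
  · rw [← pj0, zero_mul]; exact mul_nonneg rj pk
  rcases rk.eq_or_lt with rk0 | rk0
  · rw [← rk0, mul_zero]; exact mul_nonneg rj pk
  -- Wherever the positive entry `q a` sits relative to `j`, the case `q j = 0` would violate one of
  -- the two orders. Once `q j` and `q k` are positive, the two inequalities are multiplied and `q j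
  -- * q k` is cancelled.
  have qj : 0 < q j := by
    refine lt_of_le_of_ne (hq j) fun h => ?_
    rcases lt_trichotomy a j with haj | haj | haj
    · have h2 := hrq a k (haj.trans hjk)
      have h3 : 0 < r a * q k := (mul_pos ha rk0).trans_le h2
      have qk : 0 < q k := pos_of_mul_pos_right h3 (hr a)
      have h5 := hqp j k hjk
      rw [← h, zero_mul] at h5
      exact absurd h5 (mul_pos pj0 qk).not_ge
    · subst haj
      exact absurd h ha.ne
    · have h3 := hqp j a haj
      rw [← h, zero_mul] at h3
      exact absurd h3 (mul_pos pj0 ha).not_ge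
  have qk : 0 < q k := by
    have h1 := hrq j k hjk
    refine lt_of_le_of_ne (hq k) fun h => ?_
    rw [← h, mul_zero] at h1
    exact absurd h1 (mul_pos qj rk0).not_ge
  have h1 := hrq j k hjk
  have h2 := hqp j k hjk
  have h3 : (p j * q k) * (q j * r k) ≤ (q j * p k) * (r j * q k) :=
    mul_le_mul h2 h1 (mul_pos qj rk0).le (mul_nonneg qj.le pk)
  refine le_of_mul_le_mul_right ?_ (mul_pos qj qk)
  nlinarith [h3]

/-- Transition matrices which are totally positive of order two preserve the order. -/
theorem transpose_mulVec {A : Matrix (Fin X) (Fin X) ℝ} (hA : IsTP2 A) (h : LRLe q p) :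
    LRLe (Aᵀ *ᵥ q) (Aᵀ *ᵥ p) := by
  intro j k hjk
  simp only [Matrix.mulVec, dotProduct, Matrix.transpose_apply]
  rw [Finset.sum_mul_sum, Finset.sum_mul_sum, ← sub_nonneg, ← Finset.sum_sub_distrib]
  simp only [← Finset.sum_sub_distrib]
  refine sum_sum_nonneg_of_add_swap fun i m => ?_
  -- The paired terms form a minor of `(q, p)` times a minor of `A`; both change sign when `i` and
  -- `m` are exchanged.
  have e : A i j * q i * (A m k * p m) - A i j * p i * (A m k * q m) +
      (A m j * q m * (A i k * p i) - A m j * p m * (A i k * q i)) =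
      (q i * p m - p i * q m) * (A i j * A m k - A i k * A m j) := by ring
  rw [e]
  rcases lt_trichotomy i m with him | him | him
  · exact mul_nonneg (sub_nonneg.2 (h i m him)) (sub_nonneg.2 (hA i m him j k hjk))
  · subst him
    rw [mul_comm (q i), sub_self, zero_mul]
  · have h1 := h m i him
    have h2 := hA m i him j k hjk
    exact mul_nonneg_of_nonpos_of_nonpos (by linarith) (by linarith)

/-- The order of transition matrices, applied to a prior. -/
theorem of_transitionDominates {A A' : Matrix (Fin X) (Fin X) ℝ} (hA : TransitionDominates A A')
    (hp : 0 ≤ p) : LRLe (A'ᵀ *ᵥ p) (Aᵀ *ᵥ p) := by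
  intro j k hjk
  simp only [Matrix.mulVec, dotProduct, Matrix.transpose_apply]
  rw [Finset.sum_mul_sum, Finset.sum_mul_sum]
  refine Finset.sum_le_sum fun i _ => Finset.sum_le_sum fun m _ => ?_
  have := mul_le_mul_of_nonneg_right (hA i m j k hjk) (mul_nonneg (hp i) (hp m))
  linarith

/-- Reweighting by a totally positive likelihood preserves the order. -/
theorem mul_likelihood {B : Fin X → ℝ → ℝ} (hB0 : ∀ x y, 0 ≤ B x y) (hB : IsTP2 B)
    (hp : 0 ≤ p) (hq : 0 ≤ q) (h : LRLe q p) {y y' : ℝ} (hy : y ≤ y') :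
    LRLe (fun x => B x y * q x) (fun x => B x y' * p x) := by
  intro j k hjk
  have h1 : B j y' * B k y ≤ B j y * B k y' := by
    rcases hy.eq_or_lt with rfl | hy
    · exact le_rfl
    · exact hB j k hjk y y' hy
  have := mul_le_mul h1 (h j k hjk) (mul_nonneg (hp j) (hq k))
    (mul_nonneg (hB0 _ _) (hB0 _ _))
  calc B j y' * p j * (B k y * q k) = B j y' * B k y * (p j * q k) := by ring
    _ ≤ _ := this
    _ = _ := by ring

end LRLe

/-! ### Powers of stochastic matrices acting on priors. -/

section Stochastic

variable {X : ℕ} {A : Matrix (Fin X) (Fin X) ℝ}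

theorem transpose_mulVec_nonneg (hA : A ∈ Matrix.rowStochastic ℝ (Fin X)) {p : Fin X → ℝ}
    (hp : 0 ≤ p) : 0 ≤ Aᵀ *ᵥ p := by
  intro x
  simp only [Matrix.mulVec, dotProduct, Matrix.transpose_apply, Pi.zero_apply]
  exact Finset.sum_nonneg fun j _ => mul_nonneg (hA.1 j x) (hp j)

theorem sum_transpose_mulVec (hA : A ∈ Matrix.rowStochastic ℝ (Fin X)) (p : Fin X → ℝ) :
    ∑ x, (Aᵀ *ᵥ p) x = ∑ x, p x := by
  simp only [Matrix.mulVec, dotProduct, Matrix.transpose_apply]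
  rw [Finset.sum_comm]
  refine Finset.sum_congr rfl fun i _ => ?_
  have h := congrFun hA.2 i
  simp only [Matrix.mulVec, dotProduct, Pi.one_apply, mul_one] at h
  rw [← Finset.sum_mul, h, one_mul]

theorem transpose_pow_succ_mulVec (n : ℕ) (p : Fin X → ℝ) :
    (A ^ (n + 1))ᵀ *ᵥ p = Aᵀ *ᵥ ((A ^ n)ᵀ *ᵥ p) := by
  rw [pow_succ, Matrix.transpose_mul, Matrix.mulVec_mulVec]

theorem LRLe.transpose_pow_mulVec (hA : IsTP2 A) {p q : Fin X → ℝ} (h : LRLe q p) (n : ℕ) :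
    LRLe ((A ^ n)ᵀ *ᵥ q) ((A ^ n)ᵀ *ᵥ p) := by
  induction n with
  | zero => simpa using h
  | succ n ih =>
    rw [transpose_pow_succ_mulVec, transpose_pow_succ_mulVec]
    exact ih.transpose_mulVec hA

theorem eq_zero_of_sum_eq_zero {p : Fin X → ℝ} (hp : 0 ≤ p) (h : ∑ x, p x = 0) : p = 0 :=
  funext fun x => (Finset.sum_eq_zero_iff_of_nonneg fun i _ => hp i).1 h x (Finset.mem_univ x)

/-- The chain is `A'ᵀ (A'^n)ᵀ p ≤ Aᵀ (A'^n)ᵀ p ≤ Aᵀ (A^n)ᵀ p`: the first step is dominance at the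
prior `(A'^n)ᵀ p`, the second is total positivity of `A` applied to the induction hypothesis. -/
theorem LRLe.transpose_pow_of_transitionDominates {A' : Matrix (Fin X) (Fin X) ℝ}
    (hA : A ∈ Matrix.rowStochastic ℝ (Fin X)) (hA' : A' ∈ Matrix.rowStochastic ℝ (Fin X))
    (hdom : TransitionDominates A A') (htp : IsTP2 A) {p : Fin X → ℝ} (hp : 0 ≤ p) (n : ℕ) :
    LRLe ((A' ^ n)ᵀ *ᵥ p) ((A ^ n)ᵀ *ᵥ p) := by
  induction n with
  | zero => simpa using LRLe.refl p
  | succ n ih =>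
    rw [transpose_pow_succ_mulVec, transpose_pow_succ_mulVec]
    have h1 : 0 ≤ (A' ^ n)ᵀ *ᵥ p := transpose_mulVec_nonneg (pow_mem hA' n) hp
    have h2 : 0 ≤ (A ^ n)ᵀ *ᵥ p := transpose_mulVec_nonneg (pow_mem hA n) hp
    -- Transitivity needs a non-zero middle vector. If it vanishes, conservation of mass makes the
    -- prior vanish and the claim is trivial.
    by_cases h0 : Aᵀ *ᵥ ((A' ^ n)ᵀ *ᵥ p) = 0
    · have h3 := sum_transpose_mulVec hA ((A' ^ n)ᵀ *ᵥ p)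
      rw [h0] at h3
      have h4 := eq_zero_of_sum_eq_zero h1 (by simpa using h3.symm)
      rw [h4]
      intro j k _
      simp
    · exact LRLe.trans (transpose_mulVec_nonneg hA h2) (transpose_mulVec_nonneg hA h1)
        (transpose_mulVec_nonneg hA' h1) h0 (LRLe.of_transitionDominates hdom h1)
        (ih.transpose_mulVec htp)

end Stochastic

/-! ### Value functions on vectors of masses -/

/-- Superadditive and positively homogeneous functions. -/
structure Superlinear {X : ℕ} (F : (Fin X → ℝ) → ℝ) : Prop where
  superadd : ∀ p q, F p + F q ≤ F (p + q)
  homog : ∀ (t : ℝ) p, 0 ≤ t → F (t • p) = t * F p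

/-- Positively homogeneous functions whose restriction to probability vectors is monotone in the
likelihood ratio order. -/
def LRMonotone {X : ℕ} (F : (Fin X → ℝ) → ℝ) : Prop :=
  ∀ p q, 0 ≤ p → 0 ≤ q → LRLe q p → (∑ x, p x) * F q ≤ (∑ x, q x) * F p

section LRMonotone

variable {X : ℕ}

theorem lrMonotone_dotProduct {C : Fin X → ℝ} (hC : Monotone C) : LRMonotone fun p => C ⬝ᵥ p := by
  intro p q hp hq h
  simp only [dotProduct]
  rw [Finset.sum_mul_sum, Finset.sum_mul_sum, ← sub_nonneg, ← Finset.sum_sub_distrib]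
  simp only [← Finset.sum_sub_distrib]
  refine sum_sum_nonneg_of_add_swap fun i m => ?_
  have e : q i * (C m * p m) - p i * (C m * q m) + (q m * (C i * p i) - p m * (C i * q i)) =
      (q i * p m - p i * q m) * (C m - C i) := by ring
  rw [e]
  rcases lt_trichotomy i m with him | him | him
  · exact mul_nonneg (sub_nonneg.2 (h i m him)) (sub_nonneg.2 (hC him.le))
  · subst him
    rw [sub_self, mul_zero]
  · have h1 := h m i him
    exact mul_nonneg_of_nonpos_of_nonpos (by linarith) (sub_nonpos.2 (hC him.le))

/-- The common total mass cancels; if it is zero, both vectors are zero. -/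
theorem LRMonotone.le_of_sum_eq {F : (Fin X → ℝ) → ℝ} (hF : LRMonotone F) {p q : Fin X → ℝ}
    (hp : 0 ≤ p) (hq : 0 ≤ q) (h : LRLe q p) (hs : ∑ x, q x = ∑ x, p x) : F q ≤ F p := by
  have h1 := hF p q hp hq h
  rw [hs] at h1
  have h0 : 0 ≤ ∑ x, p x := Finset.sum_nonneg fun x _ => hp x
  rcases h0.eq_or_lt with h0 | h0
  · rw [eq_zero_of_sum_eq_zero hp h0.symm, eq_zero_of_sum_eq_zero hq (hs.trans h0.symm)]
  · exact le_of_mul_le_mul_left h1 h0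

end LRMonotone

/-! ### Regularity and closure properties of superlinear functions. -/

namespace Superlinear

variable {X : ℕ} {F : (Fin X → ℝ) → ℝ}

theorem map_zero (hF : Superlinear F) : F 0 = 0 := by
  simpa using hF.homog 0 0 le_rfl

theorem concaveOn (hF : Superlinear F) : ConcaveOn ℝ Set.univ F := by
  refine ⟨convex_univ, fun p _ q _ a b ha hb _ => ?_⟩
  rw [smul_eq_mul, smul_eq_mul, ← hF.homog a p ha, ← hF.homog b q hb]
  exact hF.superadd _ _

/-- Superadditivity is demanded for signed vectors too, so concavity holds on the whole space and
continuity is automatic, with no exception at the boundary of the orthant. -/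
theorem continuous (hF : Superlinear F) : Continuous F :=
  continuousOn_univ.1 (hF.concaveOn.continuousOn isOpen_univ)

/-- Compactness of the unit sphere and homogeneity give linear growth, which makes compositions with
integrable maps integrable. -/
theorem exists_bound (hF : Superlinear F) : ∃ K, ∀ p, ‖F p‖ ≤ K * ‖p‖ := by
  obtain ⟨K, hK⟩ := (isCompact_sphere (0 : Fin X → ℝ) 1).exists_bound_of_continuousOn
    hF.continuous.continuousOn
  refine ⟨K, fun p => ?_⟩
  by_cases hp : p = 0
  · simp [hp, hF.map_zero]
  · have hp' : 0 < ‖p‖ := norm_pos_iff.2 hp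
    have h1 := hK (‖p‖⁻¹ • p) (by simp [norm_smul, hp'.ne'])
    have h2 : F p = ‖p‖ * F (‖p‖⁻¹ • p) := by
      rw [← hF.homog _ _ hp'.le, smul_smul, mul_inv_cancel₀ hp'.ne', one_smul]
    rw [h2, norm_mul, norm_norm, mul_comm]
    exact mul_le_mul_of_nonneg_right h1 hp'.le

theorem integrable_comp (hF : Superlinear F) {α : Type*} [MeasurableSpace α] {μ : Measure α}
    {f : α → Fin X → ℝ} (hf : Integrable f μ) : Integrable (fun a => F (f a)) μ := by
  obtain ⟨K, hK⟩ := hF.exists_bound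
  exact (hf.norm.const_mul K).mono' (hF.continuous.comp_aestronglyMeasurable hf.1)
    (Filter.Eventually.of_forall fun a => hK _)

theorem zero : Superlinear fun _ : Fin X → ℝ => 0 := ⟨by simp, by simp⟩

theorem dotProduct (C : Fin X → ℝ) : Superlinear fun p => C ⬝ᵥ p :=
  ⟨fun p q => by rw [dotProduct_add], fun t p _ => by rw [dotProduct_smul, smul_eq_mul]⟩

theorem add {G : (Fin X → ℝ) → ℝ} (hF : Superlinear F) (hG : Superlinear G) :
    Superlinear fun p => F p + G p :=
  ⟨fun p q => by linarith [hF.superadd p q, hG.superadd p q],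
    fun t p ht => by rw [hF.homog t p ht, hG.homog t p ht, mul_add]⟩

theorem comp_mulVec (hF : Superlinear F) (M : Matrix (Fin X) (Fin X) ℝ) :
    Superlinear fun p => F (M *ᵥ p) :=
  ⟨fun p q => by rw [Matrix.mulVec_add]; exact hF.superadd _ _,
    fun t p ht => by rw [Matrix.mulVec_smul, hF.homog _ _ ht]⟩

theorem inf' {ι : Type*} {s : Finset ι} (hs : s.Nonempty) {G : ι → (Fin X → ℝ) → ℝ}
    (hG : ∀ i ∈ s, Superlinear (G i)) : Superlinear fun p => s.inf' hs fun i => G i p := by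
  refine ⟨fun p q => Finset.le_inf' _ _ fun i hi => ?_, fun t p ht => ?_⟩
  · exact (add_le_add (Finset.inf'_le _ hi) (Finset.inf'_le _ hi)).trans ((hG i hi).superadd p q)
  · have h1 : s.inf' hs (fun i => G i (t • p)) = s.inf' hs fun i => t * G i p :=
      Finset.inf'_congr hs rfl fun i hi => (hG i hi).homog t p ht
    rw [h1]
    exact (Finset.apply_inf'_eq_inf'_comp hs (fun a => t * a)
      fun a b => mul_min_of_nonneg a b ht).symm

end Superlinear

/-- The index attaining the minimum at the dominating vector `p` is tried at `q`. -/
theorem LRMonotone.inf' {X : ℕ} {ι : Type*} {s : Finset ι} (hs : s.Nonempty)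
    {G : ι → (Fin X → ℝ) → ℝ} (hG : ∀ i ∈ s, LRMonotone (G i)) :
    LRMonotone fun p => s.inf' hs fun i => G i p := by
  intro p q hp hq h
  obtain ⟨i, hi, e⟩ := Finset.exists_mem_eq_inf' hs fun i => G i p
  simp only [e]
  refine le_trans ?_ (hG i hi p q hp hq h)
  exact mul_le_mul_of_nonneg_left (Finset.inf'_le _ hi) (Finset.sum_nonneg fun x _ => hp x)

theorem LRMonotone.add {X : ℕ} {F G : (Fin X → ℝ) → ℝ} (hF : LRMonotone F) (hG : LRMonotone G) :
    LRMonotone fun p => F p + G p := by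
  intro p q hp hq h
  have h1 := hF p q hp hq h
  have h2 := hG p q hp hq h
  rw [mul_add, mul_add]
  exact add_le_add h1 h2

theorem LRMonotone.comp_transpose_pow {X : ℕ} {F : (Fin X → ℝ) → ℝ} (hF : LRMonotone F)
    {A : Matrix (Fin X) (Fin X) ℝ} (hA : A ∈ Matrix.rowStochastic ℝ (Fin X)) (htp : IsTP2 A)
    (n : ℕ) : LRMonotone fun p => F ((A ^ n)ᵀ *ᵥ p) := by
  intro p q hp hq h
  have := hF _ _ (transpose_mulVec_nonneg (pow_mem hA n) hp)
    (transpose_mulVec_nonneg (pow_mem hA n) hq) (h.transpose_pow_mulVec htp n)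
  rwa [sum_transpose_mulVec (pow_mem hA n), sum_transpose_mulVec (pow_mem hA n)] at this

/-! ### Averaging over a measurement -/

namespace SamplingModel

variable {X : ℕ}

instance (θ : SamplingModel X) : SigmaFinite θ.ν := θ.sigmaFinite

theorem integrable_B (θ : SamplingModel X) (x : Fin X) : Integrable (θ.B x) θ.ν := by
  refine ⟨(θ.B_measurable x).aestronglyMeasurable, ?_⟩
  rw [hasFiniteIntegral_iff_ofReal (Filter.Eventually.of_forall fun y => θ.B_nonneg x y),
    θ.B_lintegral]
  exact ENNReal.one_lt_top

theorem integral_B (θ : SamplingModel X) (x : Fin X) : ∫ y, θ.B x y ∂θ.ν = 1 := by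
  rw [integral_eq_lintegral_of_nonneg_ae (Filter.Eventually.of_forall fun y => θ.B_nonneg x y)
    (θ.B_measurable x).aestronglyMeasurable, θ.B_lintegral, ENNReal.toReal_one]

/-- The vector `B_y p`. -/
def weigh (θ : SamplingModel X) (p : Fin X → ℝ) (y : ℝ) : Fin X → ℝ := fun x => θ.B x y * p x

theorem weigh_nonneg (θ : SamplingModel X) {p : Fin X → ℝ} (hp : 0 ≤ p) (y : ℝ) :
    0 ≤ θ.weigh p y := fun x => mul_nonneg (θ.B_nonneg x y) (hp x)

theorem integrable_weigh (θ : SamplingModel X) (p : Fin X → ℝ) : Integrable (θ.weigh p) θ.ν :=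
  Integrable.of_eval fun x => (θ.integrable_B x).mul_const (p x)

theorem integrable_sum_weigh (θ : SamplingModel X) (p : Fin X → ℝ) :
    Integrable (fun y => ∑ x, θ.weigh p y x) θ.ν :=
  integrable_finsetSum _ fun x _ => (θ.integrable_B x).mul_const (p x)

theorem integral_sum_weigh (θ : SamplingModel X) (p : Fin X → ℝ) :
    ∫ y, ∑ x, θ.weigh p y x ∂θ.ν = ∑ x, p x := by
  simp only [weigh]
  rw [integral_finsetSum _ fun x _ => (θ.integrable_B x).mul_const (p x)]
  simp only [integral_mul_const, integral_B, one_mul]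

/-- The sum over the measurements of the values `F (B_y p)`. -/
noncomputable def observe (θ : SamplingModel X) (F : (Fin X → ℝ) → ℝ) (p : Fin X → ℝ) : ℝ :=
  ∫ y, F (θ.weigh p y) ∂θ.ν

theorem integrable_comp_weigh (θ : SamplingModel X) {F : (Fin X → ℝ) → ℝ} (hF : Superlinear F)
    (p : Fin X → ℝ) : Integrable (fun y => F (θ.weigh p y)) θ.ν :=
  hF.integrable_comp (θ.integrable_weigh p)

theorem superlinear_observe (θ : SamplingModel X) {F : (Fin X → ℝ) → ℝ} (hF : Superlinear F) :
    Superlinear (θ.observe F) := by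
  refine ⟨fun p q => ?_, fun t p ht => ?_⟩
  · simp only [observe]
    rw [← integral_add (θ.integrable_comp_weigh hF p) (θ.integrable_comp_weigh hF q)]
    refine integral_mono ((θ.integrable_comp_weigh hF p).add (θ.integrable_comp_weigh hF q))
      (θ.integrable_comp_weigh hF _) fun y => ?_
    have e : θ.weigh (p + q) y = θ.weigh p y + θ.weigh q y := by
      ext x; simp [weigh, mul_add]
    simp only [e]
    exact hF.superadd _ _
  · simp only [observe]
    rw [← integral_const_mul]
    refine integral_congr_ae (Filter.Eventually.of_forall fun y => ?_)
    have e : θ.weigh (t • p) y = t • θ.weigh p y := by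
      ext x; simp [weigh, mul_left_comm]
    simp only [e]
    exact hF.homog t _ ht

theorem observe_mono_of_le (θ : SamplingModel X) {F G : (Fin X → ℝ) → ℝ} (hF : Superlinear F)
    (hG : Superlinear G) (h : ∀ p, 0 ≤ p → F p ≤ G p) {p : Fin X → ℝ} (hp : 0 ≤ p) :
    θ.observe F p ≤ θ.observe G p :=
  integral_mono (θ.integrable_comp_weigh hF p) (θ.integrable_comp_weigh hG p)
    fun y => h _ (θ.weigh_nonneg hp y)

theorem observe_nonneg (θ : SamplingModel X) {F : (Fin X → ℝ) → ℝ}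
    (h : ∀ p, 0 ≤ p → 0 ≤ F p) {p : Fin X → ℝ} (hp : 0 ≤ p) : 0 ≤ θ.observe F p :=
  integral_nonneg fun y => h _ (θ.weigh_nonneg hp y)

/-- The pointwise inequality behind `lrMonotone_observe`: `a, b` are the masses of the smaller
vector and `c, d` those of the larger one under two measurements, and `ga, gb, gc, gd` are the
corresponding values. -/
theorem exchange_inequality {a b c d ga gb gc gd : ℝ} (ha : 0 ≤ a) (hb : 0 ≤ b) (hc : 0 ≤ c)
    (hd : 0 ≤ d) (gb0 : b = 0 → gb = 0) (gc0 : c = 0 → gc = 0)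
    (hlr : c * b ≤ a * d) (h1 : d * ga ≤ a * gd) (h2 : c * ga ≤ a * gc) (h3 : d * gb ≤ b * gd) :
    0 ≤ a * gd - d * ga + (b * gc - c * gb) := by
  rcases hb.eq_or_lt with hb0 | hb0
  · rw [gb0 hb0.symm, ← hb0]; linarith
  rcases hc.eq_or_lt with hc0 | hc0
  · rw [gc0 hc0.symm, ← hc0]; linarith
  have had : 0 < a * d := (mul_pos hc0 hb0).trans_le hlr
  have ha' : 0 < a := pos_of_mul_pos_left had hd
  have hd' : 0 < d := pos_of_mul_pos_right had ha
  -- Replacing `gc` and `gb` by these extreme values only lowers the expression, which then factors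
  -- as in `e6`.
  have e2 : (c / a) * ga ≤ gc := by
    rw [div_mul_eq_mul_div, div_le_iff₀ ha']; linarith
  have e3 : gb ≤ (b / d) * gd := by
    rw [div_mul_eq_mul_div, le_div_iff₀ hd']; linarith
  have e4 : b * ((c / a) * ga) ≤ b * gc := mul_le_mul_of_nonneg_left e2 hb
  have e5 : c * gb ≤ c * ((b / d) * gd) := mul_le_mul_of_nonneg_left e3 hc
  have e6 : a * gd - d * ga + (b * ((c / a) * ga) - c * ((b / d) * gd)) =
      (a * d - c * b) * (a * gd - d * ga) / (a * d) := by
    field_simp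
    ring
  have e7 : 0 ≤ (a * d - c * b) * (a * gd - d * ga) / (a * d) :=
    div_nonneg (mul_nonneg (sub_nonneg.2 hlr) (sub_nonneg.2 h1)) had.le
  linarith

/-- A better prior leads to a larger average over a totally positive measurement. -/
theorem lrMonotone_observe (θ : SamplingModel X) (hB : IsTP2 θ.B) {F : (Fin X → ℝ) → ℝ}
    (hF : Superlinear F) (hmono : LRMonotone F) :
    LRMonotone (θ.observe F) := by
  intro p q hp hq h
  set sp : ℝ → ℝ := fun y => ∑ x, θ.weigh p y x with hsp
  set sq : ℝ → ℝ := fun y => ∑ x, θ.weigh q y x with hsq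
  set gp : ℝ → ℝ := fun y => F (θ.weigh p y) with hgp
  set gq : ℝ → ℝ := fun y => F (θ.weigh q y) with hgq
  have isp : Integrable sp θ.ν := θ.integrable_sum_weigh p
  have isq : Integrable sq θ.ν := θ.integrable_sum_weigh q
  have igp : Integrable gp θ.ν := θ.integrable_comp_weigh hF p
  have igq : Integrable gq θ.ν := θ.integrable_comp_weigh hF q
  have sp0 : ∀ y, 0 ≤ sp y := fun y => Finset.sum_nonneg fun x _ => θ.weigh_nonneg hp y x
  have sq0 : ∀ y, 0 ≤ sq y := fun y => Finset.sum_nonneg fun x _ => θ.weigh_nonneg hq y x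
  have gp0 : ∀ y, sp y = 0 → gp y = 0 := fun y hy => by
    simp only [hgp, eq_zero_of_sum_eq_zero (θ.weigh_nonneg hp y) hy, hF.map_zero]
  have gq0 : ∀ y, sq y = 0 → gq y = 0 := fun y hy => by
    simp only [hgq, eq_zero_of_sum_eq_zero (θ.weigh_nonneg hq y) hy, hF.map_zero]
  -- The posterior from the smaller prior and smaller measurement is dominated by the one from the
  -- larger prior and larger measurement.
  have key : ∀ y y', y ≤ y' → sp y' * gq y ≤ sq y * gp y' := fun y y' hy =>
    hmono _ _ (θ.weigh_nonneg hp y') (θ.weigh_nonneg hq y)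
      (h.mul_likelihood θ.B_nonneg hB hp hq hy)
  have hlr : ∀ y y', y ≤ y' → sp y * sq y' ≤ sq y * sp y' := by
    intro y y' hy
    simp only [hsp, hsq, weigh]
    rw [Finset.sum_mul_sum, Finset.sum_mul_sum, ← sub_nonneg, ← Finset.sum_sub_distrib]
    simp only [← Finset.sum_sub_distrib]
    have hB' : ∀ i m : Fin X, i < m → θ.B i y' * θ.B m y ≤ θ.B i y * θ.B m y' := by
      intro i m him
      rcases hy.eq_or_lt with rfl | hy
      · exact le_rfl
      · exact hB i m him y y' hy
    refine sum_sum_nonneg_of_add_swap fun i m => ?_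
    have e : θ.B i y * q i * (θ.B m y' * p m) - θ.B i y * p i * (θ.B m y' * q m) +
        (θ.B m y * q m * (θ.B i y' * p i) - θ.B m y * p m * (θ.B i y' * q i)) =
        (q i * p m - p i * q m) * (θ.B i y * θ.B m y' - θ.B i y' * θ.B m y) := by ring
    rw [e]
    rcases lt_trichotomy i m with him | him | him
    · exact mul_nonneg (sub_nonneg.2 (h i m him)) (sub_nonneg.2 (hB' i m him))
    · subst him
      rw [mul_comm (q i), sub_self, zero_mul]
    · have h1 := h m i him
      have h2 := hB' m i him
      exact mul_nonneg_of_nonpos_of_nonpos (by linarith) (by linarith)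
  have point : ∀ y y', y ≤ y' →
      0 ≤ sq y * gp y' - sp y' * gq y + (sq y' * gp y - sp y * gq y') := fun y y' hy =>
    exchange_inequality (sq0 y) (sq0 y') (sp0 y) (sp0 y') (gq0 y') (gp0 y) (hlr y y' hy) (key y y' hy)
      (key y y le_rfl) (key y' y' le_rfl)
  -- For `z.1 > z.2` one half of the integrand has no definite sign, so it is symmetrised in `z.1`
  -- and `z.2`. By Fubini the integral is twice the difference to be shown non-negative.
  have int_nonneg : 0 ≤ ∫ z : ℝ × ℝ, (sq z.1 * gp z.2 - gq z.1 * sp z.2 +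
      (gp z.1 * sq z.2 - sp z.1 * gq z.2)) ∂θ.ν.prod θ.ν := by
    refine integral_nonneg fun z => ?_
    rcases le_total z.1 z.2 with hz | hz
    · have := point z.1 z.2 hz
      simp only [Pi.zero_apply]
      linarith
    · have := point z.2 z.1 hz
      simp only [Pi.zero_apply]
      linarith
  have hadd := integral_add ((isq.mul_prod igp).sub (igq.mul_prod isp))
    ((igp.mul_prod isq).sub (isp.mul_prod igq))
  simp only [Pi.sub_apply] at hadd
  rw [hadd, integral_sub (isq.mul_prod igp)
    (igq.mul_prod isp), integral_sub (igp.mul_prod isq) (isp.mul_prod igq), integral_prod_mul,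
    integral_prod_mul, integral_prod_mul, integral_prod_mul] at int_nonneg
  have e1 : ∫ y, sp y ∂θ.ν = ∑ x, p x := θ.integral_sum_weigh p
  have e2 : ∫ y, sq y ∂θ.ν = ∑ x, q x := θ.integral_sum_weigh q
  rw [e1, e2] at int_nonneg
  change (∑ x, p x) * (∫ y, gq y ∂θ.ν) ≤ (∑ x, q x) * ∫ y, gp y ∂θ.ν
  linarith

/-! #### Less accurate measurements -/

/-- The law of a measurement under the sum of the point masses on the states. -/
noncomputable def totalLaw (θ : SamplingModel X) : Measure ℝ :=
  θ.ν.withDensity fun y => ENNReal.ofReal (∑ x, θ.B x y)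

/-- The density of `obsLaw x` with respect to `totalLaw`. -/
noncomputable def likelihood (θ : SamplingModel X) (x : Fin X) (y : ℝ) : ℝ :=
  θ.B x y / ∑ z, θ.B z y

theorem sum_B_nonneg (θ : SamplingModel X) (y : ℝ) : 0 ≤ ∑ x, θ.B x y :=
  Finset.sum_nonneg fun x _ => θ.B_nonneg x y

theorem likelihood_nonneg (θ : SamplingModel X) (x : Fin X) (y : ℝ) : 0 ≤ θ.likelihood x y :=
  div_nonneg (θ.B_nonneg x y) (θ.sum_B_nonneg y)

theorem likelihood_le_one (θ : SamplingModel X) (x : Fin X) (y : ℝ) : θ.likelihood x y ≤ 1 :=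
  div_le_one_of_le₀ (Finset.single_le_sum (f := fun z => θ.B z y) (fun z _ => θ.B_nonneg z y)
    (Finset.mem_univ x)) (θ.sum_B_nonneg y)

theorem measurable_sum_B (θ : SamplingModel X) : Measurable fun y => ∑ x, θ.B x y :=
  Finset.measurable_fun_sum _ fun x _ => θ.B_measurable x

theorem measurable_likelihood (θ : SamplingModel X) (x : Fin X) : Measurable (θ.likelihood x) :=
  (θ.B_measurable x).div θ.measurable_sum_B

theorem sum_B_mul_likelihood (θ : SamplingModel X) (x : Fin X) (y : ℝ) :
    (∑ z, θ.B z y) * θ.likelihood x y = θ.B x y := by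
  by_cases h : ∑ z, θ.B z y = 0
  · have : θ.B x y = 0 :=
      (Finset.sum_eq_zero_iff_of_nonneg fun z _ => θ.B_nonneg z y).1 h x (Finset.mem_univ x)
    rw [h, zero_mul, this]
  · exact mul_div_cancel₀ _ h

theorem obsLaw_eq_withDensity (θ : SamplingModel X) (x : Fin X) :
    θ.obsLaw x = θ.totalLaw.withDensity fun y => ENNReal.ofReal (θ.likelihood x y) := by
  rw [totalLaw, ← withDensity_mul _ θ.measurable_sum_B.ennreal_ofReal
    (θ.measurable_likelihood x).ennreal_ofReal, obsLaw]
  congr 1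
  ext y
  rw [Pi.mul_apply, ← ENNReal.ofReal_mul (θ.sum_B_nonneg y), sum_B_mul_likelihood]

theorem totalLaw_apply (θ : SamplingModel X) {s : Set ℝ} (hs : MeasurableSet s) :
    θ.totalLaw s = ∑ x, θ.obsLaw x s := by
  rw [totalLaw, withDensity_apply _ hs]
  simp only [ENNReal.ofReal_sum_of_nonneg fun x (_ : x ∈ Finset.univ) => θ.B_nonneg x _]
  rw [lintegral_finsetSum _ fun x _ => (θ.B_measurable x).ennreal_ofReal]
  refine Finset.sum_congr rfl fun x _ => ?_
  rw [obsLaw, withDensity_apply _ hs]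

theorem totalLaw_eq_sum (θ : SamplingModel X) : θ.totalLaw = ∑ x, θ.obsLaw x := by
  ext s hs
  rw [θ.totalLaw_apply hs, Measure.coe_finsetSum, Finset.sum_apply]

instance (θ : SamplingModel X) : IsFiniteMeasure θ.totalLaw := by
  rw [totalLaw_eq_sum]
  infer_instance

/-- Homogeneity moves the factor `∑ z, B z y` out of `F` and into the measure. The reference
measures `ν` of two models need not be related, but their finite total laws are linked by the
garbling kernel. -/
theorem observe_eq_integral_totalLaw (θ : SamplingModel X) {F : (Fin X → ℝ) → ℝ}
    (hF : Superlinear F) (p : Fin X → ℝ) :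
    θ.observe F p = ∫ y, F (fun x => θ.likelihood x y * p x) ∂θ.totalLaw := by
  rw [totalLaw, integral_withDensity_eq_integral_toReal_smul θ.measurable_sum_B.ennreal_ofReal
    (Filter.Eventually.of_forall fun y => ENNReal.ofReal_lt_top)]
  refine integral_congr_ae (Filter.Eventually.of_forall fun y => ?_)
  simp only [ENNReal.toReal_ofReal (θ.sum_B_nonneg y), smul_eq_mul]
  rw [← hF.homog _ _ (θ.sum_B_nonneg y)]
  congr 1
  ext x
  simp only [weigh, Pi.smul_apply, smul_eq_mul]
  rw [← mul_assoc, sum_B_mul_likelihood]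

/-- The likelihood of the less accurate measurement is the posterior mean of the likelihood of the
more accurate one. -/
theorem likelihood_ae_eq_posterior_mean {θ θ' : SamplingModel X} {R : Kernel ℝ ℝ}
    [IsMarkovKernel R] (hR : ∀ x, θ.obsLaw x = (θ'.obsLaw x).bind R)
    (hT : θ.totalLaw = θ'.totalLaw.bind R) (x : Fin X) :
    ∀ᵐ y ∂θ.totalLaw,
      θ.likelihood x y = ∫ z, θ'.likelihood x z ∂(posterior R θ'.totalLaw y) := by
  have hm : Measurable fun z => ENNReal.ofReal (θ'.likelihood x z) :=
    (θ'.measurable_likelihood x).ennreal_ofReal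
  have h1 : (fun y => ENNReal.ofReal (θ.likelihood x y)) =ᵐ[θ.totalLaw]
      fun y => ∫⁻ z, ENNReal.ofReal (θ'.likelihood x z) ∂(posterior R θ'.totalLaw y) := by
    -- Over each measurable `s` both sides integrate to the integral of `θ'.likelihood x z * R z s`
    -- against `θ'.totalLaw`: on the left by garbling, on the right by disintegrating the joint law
    -- of the two measurements in the other order.
    refine ae_eq_of_forall_setLIntegral_eq_of_sigmaFinite
      (θ.measurable_likelihood x).ennreal_ofReal hm.lintegral_kernel fun s hs _ => ?_
    rw [← withDensity_apply _ hs, ← obsLaw_eq_withDensity, hR x,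
      Measure.bind_apply hs R.measurable.aemeasurable, obsLaw_eq_withDensity,
      lintegral_withDensity_eq_lintegral_mul _ hm (R.measurable_coe hs), hT]
    have hmeas : Measurable fun w : ℝ × ℝ =>
        s.indicator (fun _ => ENNReal.ofReal (θ'.likelihood x w.2)) w.1 := by
      have : (fun w : ℝ × ℝ => s.indicator (fun _ => ENNReal.ofReal (θ'.likelihood x w.2)) w.1)
          = (Prod.fst ⁻¹' s).indicator fun w => ENNReal.ofReal (θ'.likelihood x w.2) := rfl
      rw [this]
      exact (hm.comp measurable_snd).indicator (measurable_fst hs)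
    have e1 : ∫⁻ w, s.indicator (fun _ => ENNReal.ofReal (θ'.likelihood x w.2)) w.1
        ∂((θ'.totalLaw.bind R) ⊗ₘ posterior R θ'.totalLaw) =
        ∫⁻ y in s, ∫⁻ z, ENNReal.ofReal (θ'.likelihood x z) ∂(posterior R θ'.totalLaw y)
          ∂(θ'.totalLaw.bind R) := by
      rw [Measure.lintegral_compProd hmeas, ← lintegral_indicator hs]
      refine lintegral_congr fun y => ?_
      by_cases hy : y ∈ s <;> simp [hy]
    rw [← e1, compProd_posterior_eq_map_swap, lintegral_map hmeas measurable_swap,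
      Measure.lintegral_compProd (f := fun w : ℝ × ℝ =>
        s.indicator (fun _ => ENNReal.ofReal (θ'.likelihood x w.swap.2)) w.swap.1)
        (hmeas.comp measurable_swap)]
    refine lintegral_congr fun z => ?_
    simp only [Prod.fst_swap, Prod.snd_swap, Pi.mul_apply]
    rw [lintegral_indicator hs, setLIntegral_const]
  filter_upwards [h1] with y hy
  rw [integral_eq_lintegral_of_nonneg_ae
    (Filter.Eventually.of_forall fun z => θ'.likelihood_nonneg x z)
    (θ'.measurable_likelihood x).aestronglyMeasurable, ← hy,
    ENNReal.toReal_ofReal (θ.likelihood_nonneg x y)]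

theorem integrable_likelihood_mul (θ : SamplingModel X) (p : Fin X → ℝ) (μ : Measure ℝ)
    [IsFiniteMeasure μ] : Integrable (fun z x => θ.likelihood x z * p x) μ := by
  refine Integrable.of_eval fun x => Integrable.mul_const ?_ _
  refine Integrable.of_bound (θ.measurable_likelihood x).aestronglyMeasurable 1
    (Filter.Eventually.of_forall fun z => ?_)
  rw [Real.norm_of_nonneg (θ.likelihood_nonneg x z)]
  exact θ.likelihood_le_one x z

/-- Fubini for the joint law `μ ⊗ₘ κ`, whose second marginal is `μ.bind κ`. -/
theorem integrable_integral_kernel {α β : Type*} [MeasurableSpace α] [MeasurableSpace β]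
    {μ : Measure α} [IsFiniteMeasure μ] {κ : Kernel α β} [IsMarkovKernel κ] {g : β → ℝ}
    (hg : Integrable g (μ.bind κ)) :
    Integrable (fun a => ∫ b, g b ∂κ a) μ ∧ ∫ b, g b ∂(μ.bind κ) = ∫ a, ∫ b, g b ∂κ a ∂μ := by
  have h1 : Integrable (fun w : α × β => g w.2) (μ ⊗ₘ κ) :=
    (Measure.integrable_compProd_snd_iff hg.1).2 hg
  have h2 := Integrable.integral_compProd (κ := Kernel.const Unit μ)
    (η := Kernel.prodMkLeft Unit κ) (a := ()) h1
  refine ⟨by simpa using h2, ?_⟩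
  rw [← Measure.integral_compProd h1, ← Measure.snd_compProd, Measure.snd,
    integral_map measurable_snd.aemeasurable]
  rw [← Measure.snd, Measure.snd_compProd]
  exact hg.1

/-- More accurate measurements decrease the average of a concave function. -/
theorem observe_le_of_reverseBlackwell {θ θ' : SamplingModel X} (h : ReverseBlackwell θ θ')
    {F : (Fin X → ℝ) → ℝ} (hF : Superlinear F) (p : Fin X → ℝ) :
    θ'.observe F p ≤ θ.observe F p := by
  obtain ⟨R, hRm, hR⟩ := h
  have hT : θ.totalLaw = θ'.totalLaw.bind R := by
    ext s hs
    rw [totalLaw_apply _ hs, Measure.bind_apply hs R.measurable.aemeasurable, totalLaw_eq_sum,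
      lintegral_finsetSum_measure]
    refine Finset.sum_congr rfl fun x _ => ?_
    rw [hR x, Measure.bind_apply hs R.measurable.aemeasurable]
  rw [observe_eq_integral_totalLaw _ hF, observe_eq_integral_totalLaw _ hF]
  set g : ℝ → ℝ := fun z => F fun x => θ'.likelihood x z * p x with hg
  have gint : ∀ (μ : Measure ℝ) [IsFiniteMeasure μ], Integrable g μ := fun μ _ =>
    hF.integrable_comp (θ'.integrable_likelihood_mul p μ)
  -- The finer law is the average, over the coarser measurement `y`, of the posterior laws of the
  -- finer one; Jensen's inequality is then applied for each `y`.
  have h1 : θ'.totalLaw = θ.totalLaw.bind (posterior R θ'.totalLaw) := by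
    rw [hT]
    exact posterior_comp_self.symm
  have h2 : Integrable g (θ.totalLaw.bind (posterior R θ'.totalLaw)) := h1 ▸ gint θ'.totalLaw
  obtain ⟨h3, h4⟩ := integrable_integral_kernel h2
  rw [← h1] at h4
  rw [h4]
  refine integral_mono_ae h3 (hF.integrable_comp (θ.integrable_likelihood_mul p _)) ?_
  filter_upwards [ae_all_iff.2 fun x => likelihood_ae_eq_posterior_mean hR hT x] with y hy
  have hv := θ'.integrable_likelihood_mul p (posterior R θ'.totalLaw y)
  have h5 := hF.concaveOn.le_map_integral hF.continuous.continuousOn isClosed_univ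
    (Filter.Eventually.of_forall fun _ => Set.mem_univ _) hv (gint _)
  have h6 : ∫ z, (fun x => θ'.likelihood x z * p x) ∂(posterior R θ'.totalLaw y) =
      fun x => θ.likelihood x y * p x := by
    ext x
    rw [eval_integral fun i => Integrable.eval hv i, integral_mul_const, hy x]
  rw [h6] at h5
  exact h5

end SamplingModel

/-! ### The Markov property of the trajectory -/

/-- Prepend a value to a path. -/
def consPath {S : Type*} (s : S) (ω : ℕ → S) : ℕ → S
  | 0 => s
  | n + 1 => ω n

/-- Drop the first `n` values of a path. -/
def shiftPath {S : Type*} (n : ℕ) (ω : ℕ → S) : ℕ → S := fun t => ω (n + t)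

section Path

variable {S : Type*} [MeasurableSpace S]

theorem measurable_consPath : Measurable fun w : S × (ℕ → S) => consPath w.1 w.2 := by
  refine measurable_pi_lambda _ fun n => ?_
  cases n with
  | zero => exact measurable_fst
  | succ n => exact (measurable_pi_apply n).comp measurable_snd

theorem measurable_shiftPath (n : ℕ) : Measurable (shiftPath n : (ℕ → S) → ℕ → S) :=
  measurable_pi_lambda _ fun _ => measurable_pi_apply _

/-- Two laws of trajectories with the same initial law and the same transition kernels agree. -/
theorem ext_of_map_frestrictLe_compProd {κ : (n : ℕ) → Kernel (Π _ : Finset.Iic n, S) S}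
    {M M' : Measure (ℕ → S)} [IsProbabilityMeasure M] [IsProbabilityMeasure M']
    (h0 : M.map (fun ω => ω 0) = M'.map fun ω => ω 0)
    (hM : ∀ n, M.map (Preorder.frestrictLe n) ⊗ₘ κ n =
      M.map fun ω => (Preorder.frestrictLe n ω, ω (n + 1)))
    (hM' : ∀ n, M'.map (Preorder.frestrictLe n) ⊗ₘ κ n =
      M'.map fun ω => (Preorder.frestrictLe n ω, ω (n + 1))) : M = M' := by
  have hmf : ∀ n : ℕ, Measurable (Preorder.frestrictLe (π := fun _ : ℕ => S) n) := fun n =>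
    Preorder.measurable_frestrictLe n
  have key : ∀ n : ℕ, M.map (Preorder.frestrictLe n) = M'.map (Preorder.frestrictLe n) := by
    intro n
    induction n with
    | zero =>
      have hφ : Measurable fun (s : S) (_ : Finset.Iic 0) => s :=
        measurable_pi_lambda _ fun _ => measurable_id
      have e : (Preorder.frestrictLe (π := fun _ : ℕ => S) 0) =
          (fun (s : S) (_ : Finset.Iic 0) => s) ∘ fun ω => ω 0 := by
        ext ω i
        obtain ⟨i, hi⟩ := i
        have : i = 0 := by simpa using hi
        subst this
        rfl
      rw [e, ← Measure.map_map hφ (measurable_pi_apply 0), h0,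
        Measure.map_map hφ (measurable_pi_apply 0)]
    | succ n ih =>
      -- `φ` appends the next value to a history; the laws of all initial segments then determine
      -- the law of the path.
      let φ : (Π _ : Finset.Iic n, S) × S → Π _ : Finset.Iic (n + 1), S := fun w i =>
        if h : (i : ℕ) ≤ n then w.1 ⟨i, Finset.mem_Iic.2 h⟩ else w.2
      have hφ : Measurable φ := by
        refine measurable_pi_lambda _ fun i => ?_
        by_cases h : (i : ℕ) ≤ n
        · simp only [φ, h, dif_pos]
          exact (measurable_pi_apply _).comp measurable_fst
        · simp only [φ, h, dif_neg, not_false_eq_true]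
          exact measurable_snd
      have e : (Preorder.frestrictLe (π := fun _ : ℕ => S) (n + 1)) =
          φ ∘ fun ω => (Preorder.frestrictLe n ω, ω (n + 1)) := by
        ext ω i
        obtain ⟨i, hi⟩ := i
        by_cases h : i ≤ n
        · simp [φ, h]
        · have : i = n + 1 := le_antisymm (Finset.mem_Iic.1 hi) (by omega)
          subst this
          simp [φ]
      have hp : Measurable fun ω : ℕ → S => (Preorder.frestrictLe (π := fun _ : ℕ => S) n ω,
          ω (n + 1)) := (hmf n).prodMk (measurable_pi_apply _)
      rw [e, ← Measure.map_map hφ hp, ← hM n, ih, hM' n, Measure.map_map hφ hp]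
  have hlim : ∀ I : Finset ℕ, M.map I.restrict = M'.map I.restrict := by
    intro I
    have hI : I ⊆ Finset.Iic (I.sup id) := fun i hi =>
      Finset.mem_Iic.2 (Finset.le_sup (f := id) hi)
    have hr : Measurable (Finset.restrict₂ (π := fun _ : ℕ => S) hI) :=
      Finset.measurable_restrict₂ hI
    have e : I.restrict (π := fun _ : ℕ => S) =
        Finset.restrict₂ hI ∘ Preorder.frestrictLe (I.sup id) := rfl
    rw [e, ← Measure.map_map hr (hmf _), key, Measure.map_map hr (hmf _)]
  exact IsProjectiveLimit.unique (P := fun I => M'.map I.restrict) hlim fun _ => rfl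

end Path

/-! ### The trajectory law conditioned on its initial state. -/

namespace SamplingModel

variable {X L : ℕ}

/-- The belief that the next state has the law given by a row of the transition matrix. -/
def row (θ : SamplingModel X) (x : Fin X) : Belief X := ⟨θ.A x, θ.A_row_mem x⟩

/-- The kernel giving the next state and measurement in terms of the past. -/
noncomputable def stepFrom (θ : SamplingModel X) (n : ℕ) :
    Kernel (Π _ : Finset.Iic n, Fin X × ℝ) (Fin X × ℝ) :=
  θ.step.comap (fun h => h ⟨n, Finset.mem_Iic.2 le_rfl⟩) (measurable_pi_apply _)

instance (θ : SamplingModel X) (n : ℕ) : IsMarkovKernel (θ.stepFrom n) := by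
  unfold stepFrom; infer_instance

theorem pathLaw_eq (θ : SamplingModel X) (π : Belief X) :
    θ.pathLaw π = Kernel.trajMeasure (X := fun _ => Fin X × ℝ) (θ.jointLaw π) θ.stepFrom := rfl

instance (θ : SamplingModel X) (π : Belief X) : IsProbabilityMeasure (θ.jointLaw π) :=
  θ.isProbabilityMeasure_jointLaw π.2

instance (θ : SamplingModel X) (π : Belief X) : IsProbabilityMeasure (θ.pathLaw π) := by
  rw [pathLaw_eq]; infer_instance

theorem map_pathLaw_zero (θ : SamplingModel X) (π : Belief X) :
    (θ.pathLaw π).map (fun ω => ω 0) = θ.jointLaw π := by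
  have h1 : (θ.pathLaw π).map (Preorder.frestrictLe 0) =
      (θ.jointLaw π).map (MeasurableEquiv.piUnique fun _ : Finset.Iic 0 => Fin X × ℝ).symm := by
    rw [pathLaw_eq, Kernel.trajMeasure, Measure.map_comp _ _ (by fun_prop),
      Kernel.traj_map_frestrictLe, Kernel.partialTraj_self, Measure.id_comp]
  have e : (fun ω : ℕ → Fin X × ℝ => ω 0) =
      (fun h : (Π _ : Finset.Iic 0, Fin X × ℝ) => h ⟨0, Finset.mem_Iic.2 le_rfl⟩) ∘
        Preorder.frestrictLe 0 := rfl
  have hev : Measurable fun h : (Π _ : Finset.Iic 0, Fin X × ℝ) =>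
      h ⟨0, Finset.mem_Iic.2 le_rfl⟩ := measurable_pi_apply _
  rw [e, ← Measure.map_map hev (Preorder.measurable_frestrictLe 0), h1,
    Measure.map_map hev (MeasurableEquiv.measurable _)]
  exact Measure.map_id

theorem map_pathLaw_compProd (θ : SamplingModel X) (π : Belief X) (n : ℕ) :
    (θ.pathLaw π).map (Preorder.frestrictLe n) ⊗ₘ θ.stepFrom n =
      (θ.pathLaw π).map fun ω => (Preorder.frestrictLe n ω, ω (n + 1)) := by
  rw [pathLaw_eq]
  exact Kernel.map_frestrictLe_trajMeasure_compProd_eq_map_trajMeasure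

theorem lintegral_pathLaw_succ (θ : SamplingModel X) (π : Belief X) (n : ℕ)
    {f : (Π _ : Finset.Iic n, Fin X × ℝ) × (Fin X × ℝ) → ℝ≥0∞} (hf : Measurable f) :
    ∫⁻ ω, f (Preorder.frestrictLe n ω, ω (n + 1)) ∂θ.pathLaw π =
      ∫⁻ ω, ∫⁻ s, f (Preorder.frestrictLe n ω, s) ∂θ.step (ω n) ∂θ.pathLaw π := by
  have hm : Measurable fun ω : ℕ → Fin X × ℝ =>
      (Preorder.frestrictLe (π := fun _ : ℕ => Fin X × ℝ) n ω, ω (n + 1)) :=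
    (Preorder.measurable_frestrictLe n).prodMk (measurable_pi_apply _)
  rw [← lintegral_map hf hm, ← map_pathLaw_compProd, Measure.lintegral_compProd hf,
    lintegral_map hf.lintegral_kernel_prod_right' (Preorder.measurable_frestrictLe n)]
  rfl

/-- The law of the trajectory which starts in `x`. -/
noncomputable def startLaw (θ : SamplingModel X) (x : Fin X) : Measure (ℕ → Fin X × ℝ) :=
  ((θ.obsLaw x).prod (θ.pathLaw (θ.row x))).map fun w => consPath (x, w.1) w.2

theorem measurable_consPath_obs (x : Fin X) :
    Measurable fun w : ℝ × (ℕ → Fin X × ℝ) => consPath (x, w.1) w.2 :=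
  measurable_consPath.comp ((measurable_const.prodMk measurable_fst).prodMk measurable_snd)

instance (θ : SamplingModel X) (x : Fin X) : IsProbabilityMeasure (θ.startLaw x) :=
  Measure.isProbabilityMeasure_map (measurable_consPath_obs x).aemeasurable

theorem lintegral_startLaw (θ : SamplingModel X) (x : Fin X) {Φ : (ℕ → Fin X × ℝ) → ℝ≥0∞}
    (hΦ : Measurable Φ) : ∫⁻ ω, Φ ω ∂θ.startLaw x =
      ∫⁻ y, ∫⁻ ω, Φ (consPath (x, y) ω) ∂θ.pathLaw (θ.row x) ∂θ.obsLaw x := by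
  rw [startLaw, lintegral_map hΦ (measurable_consPath_obs x),
    lintegral_prod (fun w : ℝ × (ℕ → Fin X × ℝ) => Φ (consPath (x, w.1) w.2))
      (hΦ.comp (measurable_consPath_obs x)).aemeasurable]

/-- Prepending `x` to a trajectory started from the row of `A` at `x` respects the transition
kernels. This lets uniqueness of the trajectory law yield `pathLaw_eq_sum`. -/
theorem startLaw_map_compProd (θ : SamplingModel X) (x : Fin X) (n : ℕ) :
    (θ.startLaw x).map (Preorder.frestrictLe n) ⊗ₘ θ.stepFrom n =
      (θ.startLaw x).map fun ω => (Preorder.frestrictLe n ω, ω (n + 1)) := by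
  have hm : Measurable fun ω : ℕ → Fin X × ℝ =>
      (Preorder.frestrictLe (π := fun _ : ℕ => Fin X × ℝ) n ω, ω (n + 1)) :=
    (Preorder.measurable_frestrictLe n).prodMk (measurable_pi_apply _)
  refine Measure.ext_of_lintegral _ fun f hf => ?_
  have hk : Measurable fun h : (Π _ : Finset.Iic n, Fin X × ℝ) =>
      ∫⁻ s, f (h, s) ∂θ.stepFrom n h := hf.lintegral_kernel_prod_right'
  rw [lintegral_map hf hm, Measure.lintegral_compProd hf, lintegral_map hk
    (Preorder.measurable_frestrictLe n), lintegral_startLaw _ _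
      (Φ := fun ω => f (Preorder.frestrictLe n ω, ω (n + 1))) (hf.comp hm),
    lintegral_startLaw _ _ (Φ := fun ω => ∫⁻ s, f (Preorder.frestrictLe n ω, s)
      ∂θ.stepFrom n (Preorder.frestrictLe n ω)) (hk.comp (Preorder.measurable_frestrictLe n))]
  refine lintegral_congr fun y => ?_
  cases n with
  | zero =>
    set c : Π _ : Finset.Iic 0, Fin X × ℝ := fun _ => (x, y)
    have hc : ∀ ω, Preorder.frestrictLe (π := fun _ : ℕ => Fin X × ℝ) 0
        (consPath (x, y) ω) = c := by
      intro ω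
      ext1 i
      obtain ⟨i, hi⟩ := i
      have : i = 0 := by simpa using hi
      subst this
      rfl
    simp only [hc, consPath]
    have hfc : Measurable fun s => f (c, s) := hf.comp measurable_prodMk_left
    rw [lintegral_const, measure_univ, mul_one,
      ← lintegral_map (g := fun ω : ℕ → Fin X × ℝ => ω 0) hfc (measurable_pi_apply 0),
      map_pathLaw_zero]
    rfl
  | succ n =>
    -- `ψ` prepends `(x, y)` to a history, which reduces the claim to the transition property of the
    -- tail one index earlier.
    let ψ : (Π _ : Finset.Iic n, Fin X × ℝ) → Π _ : Finset.Iic (n + 1), Fin X × ℝ := fun h i =>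
      if hi : (i : ℕ) = 0 then (x, y) else
        h ⟨(i : ℕ) - 1, Finset.mem_Iic.2 (by have := Finset.mem_Iic.1 i.2; omega)⟩
    have hψ : Measurable ψ := by
      refine measurable_pi_lambda _ fun i => ?_
      by_cases hi : (i : ℕ) = 0
      · simp only [ψ, hi, dif_pos]
        exact measurable_const
      · simp only [ψ, hi, dif_neg, not_false_eq_true]
        exact measurable_pi_apply _
    have hψe : ∀ ω, Preorder.frestrictLe (π := fun _ : ℕ => Fin X × ℝ) (n + 1)
        (consPath (x, y) ω) = ψ (Preorder.frestrictLe n ω) := by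
      intro ω
      ext1 i
      obtain ⟨i, hi⟩ := i
      cases i with
      | zero => rfl
      | succ i => rfl
    have hg : Measurable fun w : (Π _ : Finset.Iic n, Fin X × ℝ) × (Fin X × ℝ) =>
        f (ψ w.1, w.2) := hf.comp ((hψ.comp measurable_fst).prodMk measurable_snd)
    simp only [hψe, consPath]
    refine Eq.trans ?_ (θ.lintegral_pathLaw_succ (θ.row x) n hg).symm
    rfl

theorem map_startLaw_zero (θ : SamplingModel X) (x : Fin X) :
    (θ.startLaw x).map (fun ω => ω 0) = (Measure.dirac x).prod (θ.obsLaw x) := by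
  refine Measure.ext_of_lintegral _ fun f hf => ?_
  rw [lintegral_map hf (measurable_pi_apply 0),
    lintegral_startLaw _ _ (Φ := fun ω => f (ω 0)) (hf.comp (measurable_pi_apply 0)), lintegral_prod _ hf.aemeasurable,
    lintegral_dirac]
  simp [consPath]

/-- Decomposition of the law of the trajectory according to the initial state. -/
theorem pathLaw_eq_sum (θ : SamplingModel X) (π : Belief X) :
    θ.pathLaw π = ∑ x, ENNReal.ofReal (π.1 x) • θ.startLaw x := by
  have hmf : ∀ n : ℕ, Measurable (Preorder.frestrictLe (π := fun _ : ℕ => Fin X × ℝ) n) := fun n =>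
    Preorder.measurable_frestrictLe n
  have hprob : IsProbabilityMeasure (∑ x, ENNReal.ofReal (π.1 x) • θ.startLaw x) := by
    constructor
    simp only [Measure.coe_finsetSum, Finset.sum_apply, Measure.smul_apply, measure_univ,
      smul_eq_mul, mul_one]
    rw [← ENNReal.ofReal_sum_of_nonneg fun x _ => π.2.1 x, π.2.2, ENNReal.ofReal_one]
  have hmap : ∀ {T : Type} [MeasurableSpace T] {g : (ℕ → Fin X × ℝ) → T}, Measurable g →
      (∑ x, ENNReal.ofReal (π.1 x) • θ.startLaw x).map g =
        ∑ x, ENNReal.ofReal (π.1 x) • (θ.startLaw x).map g := by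
    intro T _ g hg
    refine Measure.ext_of_lintegral _ fun f hf => ?_
    rw [lintegral_map hf hg, lintegral_finsetSum_measure, lintegral_finsetSum_measure]
    simp only [lintegral_smul_measure, lintegral_map hf hg]
  refine ext_of_map_frestrictLe_compProd (κ := θ.stepFrom) ?_ (θ.map_pathLaw_compProd π)
    fun n => ?_
  · rw [map_pathLaw_zero, hmap (measurable_pi_apply 0)]
    simp only [map_startLaw_zero]
    rfl
  · have hm : Measurable fun ω : ℕ → Fin X × ℝ =>
        (Preorder.frestrictLe (π := fun _ : ℕ => Fin X × ℝ) n ω, ω (n + 1)) :=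
      (hmf n).prodMk (measurable_pi_apply _)
    rw [hmap hm]
    simp only [← startLaw_map_compProd]
    refine Measure.ext_of_lintegral _ fun f hf => ?_
    have hk : Measurable fun h : (Π _ : Finset.Iic n, Fin X × ℝ) =>
        ∫⁻ s, f (h, s) ∂θ.stepFrom n h := hf.lintegral_kernel_prod_right'
    rw [Measure.lintegral_compProd hf, lintegral_map hk (hmf n), lintegral_finsetSum_measure,
      lintegral_finsetSum_measure]
    simp only [lintegral_smul_measure, Measure.lintegral_compProd hf, lintegral_map hk (hmf n)]

theorem lintegral_pathLaw (θ : SamplingModel X) (π : Belief X) (Φ : (ℕ → Fin X × ℝ) → ℝ≥0∞) :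
    ∫⁻ ω, Φ ω ∂θ.pathLaw π = ∑ x, ENNReal.ofReal (π.1 x) * ∫⁻ ω, Φ ω ∂θ.startLaw x := by
  rw [pathLaw_eq_sum, lintegral_finsetSum_measure]
  simp only [lintegral_smul_measure, smul_eq_mul]

/-- The Markov property. -/
theorem lintegral_startLaw_shift (θ : SamplingModel X) (n : ℕ) (x : Fin X)
    {Φ : (ℕ → Fin X × ℝ) → ℝ≥0∞} (hΦ : Measurable Φ) :
    ∫⁻ ω, Φ (shiftPath n ω) ∂θ.startLaw x =
      ∑ z, ENNReal.ofReal ((θ.A ^ n) x z) * ∫⁻ ω, Φ ω ∂θ.startLaw z := by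
  induction n generalizing x with
  | zero =>
    have e : ∀ ω : ℕ → Fin X × ℝ, shiftPath 0 ω = ω := fun ω => by
      ext1 t; simp [shiftPath]
    simp only [e, pow_zero]
    rw [Finset.sum_eq_single x]
    · simp
    · intro z _ hz
      simp [Matrix.one_apply_ne hz.symm]
    · simp
  | succ n ih =>
    rw [lintegral_startLaw _ _ (Φ := fun ω => Φ (shiftPath (n + 1) ω))
      (hΦ.comp (measurable_shiftPath _))]
    have e : ∀ (y : ℝ) (ω : ℕ → Fin X × ℝ), shiftPath (n + 1) (consPath (x, y) ω) = shiftPath n ω := by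
      intro y ω
      ext1 t
      simp only [shiftPath, add_right_comm n 1 t, consPath]
    simp only [e]
    rw [lintegral_const, measure_univ, mul_one, lintegral_pathLaw]
    simp only [ih, row, Finset.mul_sum]
    rw [Finset.sum_comm]
    refine Finset.sum_congr rfl fun z _ => ?_
    rw [pow_succ', Matrix.mul_apply, ENNReal.ofReal_sum_of_nonneg fun w _ =>
      mul_nonneg (θ.A_stochastic.1 x w) ((pow_mem θ.A_stochastic n).1 w z), Finset.sum_mul]
    refine Finset.sum_congr rfl fun w _ => ?_
    rw [ENNReal.ofReal_mul (θ.A_stochastic.1 x w), mul_assoc]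

theorem lintegral_startLaw_state (θ : SamplingModel X) (x : Fin X) (g : Fin X → ℝ≥0∞) :
    ∫⁻ ω, g (ω 0).1 ∂θ.startLaw x = g x := by
  rw [lintegral_startLaw _ _ (Φ := fun ω => g (ω 0).1) ((measurable_of_finite g).comp
    (measurable_fst.comp (measurable_pi_apply 0)))]
  simp [consPath]

theorem lintegral_startLaw_state_at (θ : SamplingModel X) (x : Fin X) (n : ℕ)
    (g : Fin X → ℝ≥0∞) :
    ∫⁻ ω, g (ω n).1 ∂θ.startLaw x = ∑ z, ENNReal.ofReal ((θ.A ^ n) x z) * g z := by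
  have := θ.lintegral_startLaw_shift n x (Φ := fun ω => g (ω 0).1)
    ((measurable_of_finite g).comp (measurable_fst.comp (measurable_pi_apply 0)))
  simpa [lintegral_startLaw_state, shiftPath] using this

end SamplingModel

/-! ### The cost of the first decisions -/

namespace SamplingModel

variable {X L : ℕ}

/-- With finitely many actions, measurability may be checked with the action frozen. -/
theorem measurable_of_forall_action {α β : Type*} [MeasurableSpace α] [MeasurableSpace β]
    {u : α → Fin (L + 1)} (hu : Measurable u) {G : Fin (L + 1) → α → β}
    (hG : ∀ v, Measurable (G v)) : Measurable fun a => G (u a) a :=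
  (measurable_from_prod_countable_right (f := fun w : Fin (L + 1) × α => G w.1 w.2) hG).comp
    (hu.prodMk measurable_id)

theorem measurable_predict (θ : SamplingModel X) (P : SamplingProtocol X L) (u : Fin (L + 1))
    (x : Fin X) : Measurable fun π : Belief X => θ.predict P π u x := by
  simp only [predict, Matrix.mulVec, dotProduct]
  exact Finset.measurable_fun_sum _ fun j _ =>
    ((measurable_pi_apply j).comp measurable_subtype_coe).const_mul _

theorem measurable_sigma (θ : SamplingModel X) (P : SamplingProtocol X L) (u : Fin (L + 1)) :
    Measurable fun w : Belief X × ℝ => θ.sigma P w.1 w.2 u := by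
  simp only [sigma]
  exact Finset.measurable_fun_sum _ fun x _ => ((θ.B_measurable x).comp measurable_snd).mul
    ((θ.measurable_predict P u x).comp measurable_fst)

theorem sigma_nonneg (θ : SamplingModel X) (P : SamplingProtocol X L) (π : Belief X) (y : ℝ)
    (u : Fin (L + 1)) : 0 ≤ θ.sigma P π y u :=
  Finset.sum_nonneg fun x _ => mul_nonneg (θ.B_nonneg x y) (θ.predict_nonneg P π u x)

theorem measurable_filter (θ : SamplingModel X) (P : SamplingProtocol X L) (u : Fin (L + 1)) :
    Measurable fun w : Belief X × ℝ => θ.filter P w.1 w.2 u := by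
  have hs : MeasurableSet (stdSimplex ℝ (Fin X)) := (isClosed_stdSimplex ℝ (Fin X)).measurableSet
  refine (MeasurableEmbedding.subtype_coe hs).measurable_comp_iff.1 (measurable_pi_iff.2 fun x => ?_)
  have e : (fun w : Belief X × ℝ => (Subtype.val ∘ fun w : Belief X × ℝ =>
      θ.filter P w.1 w.2 u) w x) = fun w => if 0 < θ.sigma P w.1 w.2 u then
        θ.B x w.2 * θ.predict P w.1 u x / θ.sigma P w.1 w.2 u else w.1.1 x := by
    ext w
    simp only [Function.comp_apply, filter]
    split_ifs <;> rfl
  rw [e]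
  refine Measurable.ite (measurableSet_lt measurable_const (θ.measurable_sigma P u)) ?_ ?_
  · exact (((θ.B_measurable x).comp measurable_snd).mul
      ((θ.measurable_predict P u x).comp measurable_fst)).div (θ.measurable_sigma P u)
  · exact (measurable_pi_apply x).comp (measurable_subtype_coe.comp measurable_fst)

/-- The defining relation of the Bayesian update, which also holds where `σ` vanishes. -/
theorem sigma_mul_filter (θ : SamplingModel X) (P : SamplingProtocol X L) (π : Belief X) (y : ℝ)
    (u : Fin (L + 1)) (x : Fin X) :
    θ.sigma P π y u * (θ.filter P π y u).1 x = θ.B x y * θ.predict P π u x := by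
  by_cases h : 0 < θ.sigma P π y u
  · simp only [filter, dif_pos h]
    exact mul_div_cancel₀ _ h.ne'
  · have h0 : θ.sigma P π y u = 0 := le_antisymm (not_lt.1 h) (θ.sigma_nonneg P π y u)
    rw [h0, zero_mul]
    exact ((Finset.sum_eq_zero_iff_of_nonneg fun z _ => mul_nonneg (θ.B_nonneg z y)
      (θ.predict_nonneg P π u z)).1 h0 x (Finset.mem_univ x)).symm

/-- The Markov property at a sampling time: a functional of the measurement taken there and of the
subsequent path, which otherwise does not use that measurement. -/
theorem lintegral_startLaw_shift_obs (θ : SamplingModel X) (n : ℕ) (x : Fin X)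
    {Ψ : ℝ → (ℕ → Fin X × ℝ) → ℝ≥0∞}
    (hΨ : Measurable fun w : ℝ × (ℕ → Fin X × ℝ) => Ψ w.1 w.2)
    (hc : ∀ y z y' ω, Ψ y (consPath (z, y') ω) = Ψ y (consPath (z, y) ω)) :
    ∫⁻ ω, Ψ (ω n).2 (shiftPath n ω) ∂θ.startLaw x =
      ∑ z, ENNReal.ofReal ((θ.A ^ n) x z) *
        ∫⁻ y, ∫⁻ ω, Ψ y ω ∂θ.startLaw z ∂θ.obsLaw z := by
  have hobs : Measurable fun ω : ℕ → Fin X × ℝ => ((ω 0).2, ω) :=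
    (measurable_snd.comp (measurable_pi_apply 0)).prodMk measurable_id
  -- The measurement at time `n` is the one at time `0` of the shifted path. By `hc` the path may
  -- then carry an independent measurement `y'` there instead.
  have hm : Measurable fun ω : ℕ → Fin X × ℝ => Ψ (ω 0).2 ω := hΨ.comp hobs
  refine (θ.lintegral_startLaw_shift n x hm).trans (Finset.sum_congr rfl fun z _ => ?_)
  congr 1
  rw [lintegral_startLaw _ _ hm]
  refine lintegral_congr fun y => ?_
  have hy : Measurable fun ω => Ψ y ω := hΨ.comp measurable_prodMk_left
  rw [lintegral_startLaw _ _ hy,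
    lintegral_congr fun y' => lintegral_congr fun ω => hc y z y' ω, lintegral_const, measure_univ,
    mul_one]
  rfl

/-! ### Regeneration of beliefs and costs at the sampling times. -/

section Epoch

variable (θ : SamplingModel X) (P : SamplingProtocol X L) (μ : SamplingStrategy X L)

/-- The recursion defining `epoch` adds the last decision; this form peels off the first one, as the
Markov property requires. -/
theorem epoch_succ_eq_shift (π : Belief X) (ω : ℕ → Fin X × ℝ) (k : ℕ) :
    θ.epoch P μ π ω (k + 1) =
      (P.D (μ.1 π) + (θ.epoch P μ (θ.filter P π (ω (P.D (μ.1 π))).2 (μ.1 π))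
        (shiftPath (P.D (μ.1 π)) ω) k).1,
      (θ.epoch P μ (θ.filter P π (ω (P.D (μ.1 π))).2 (μ.1 π))
        (shiftPath (P.D (μ.1 π)) ω) k).2) := by
  induction k with
  | zero => simp [epoch]
  | succ k ih =>
    rw [epoch, ih]
    conv_rhs => rw [epoch]
    simp only [shiftPath, add_assoc]

theorem epochCost_zero (π : Belief X) (ω : ℕ → Fin X × ℝ) :
    θ.epochCost P μ π ω 0 = if μ.1 π = 0 then P.c (ω 0).1 0 else
      P.m (ω 0).1 (μ.1 π) + ∑ t ∈ Finset.range (P.D (μ.1 π)), P.c (ω t).1 (μ.1 π) := by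
  simp [epochCost, epoch]

theorem epochCost_succ (π : Belief X) (ω : ℕ → Fin X × ℝ) (k : ℕ) :
    θ.epochCost P μ π ω (k + 1) = if μ.1 π = 0 then 0 else
      θ.epochCost P μ (θ.filter P π (ω (P.D (μ.1 π))).2 (μ.1 π))
        (shiftPath (P.D (μ.1 π)) ω) k := by
  by_cases h0 : μ.1 π = 0
  · rw [if_pos h0, epochCost, if_pos ⟨0, Nat.succ_pos k, h0⟩]
  rw [if_neg h0, epochCost, epochCost]
  have hiff : (∃ j < k + 1, μ.1 (θ.epoch P μ π ω j).2 = 0) ↔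
      ∃ j < k, μ.1 (θ.epoch P μ (θ.filter P π (ω (P.D (μ.1 π))).2 (μ.1 π))
        (shiftPath (P.D (μ.1 π)) ω) j).2 = 0 := by
    constructor
    · rintro ⟨j, hj, h⟩
      cases j with
      | zero => exact absurd h h0
      | succ j =>
        rw [epoch_succ_eq_shift] at h
        exact ⟨j, by omega, h⟩
    · rintro ⟨j, hj, h⟩
      refine ⟨j + 1, by omega, ?_⟩
      rw [epoch_succ_eq_shift]
      exact h
  simp only [hiff, epoch_succ_eq_shift, add_assoc]
  congr 1
  simp only [shiftPath]
  congr 2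
  rw [Finset.sum_Ico_eq_sum_range, Finset.sum_Ico_eq_sum_range]
  refine Finset.sum_congr (by congr 1; omega) fun t _ => ?_
  rw [add_assoc]

theorem measurable_epochCost (k : ℕ) :
    Measurable fun w : Belief X × (ℕ → Fin X × ℝ) => θ.epochCost P μ w.1 w.2 k := by
  have hobs : ∀ n : ℕ, Measurable fun w : Belief X × (ℕ → Fin X × ℝ) => (w.2 n).2 := fun n =>
    measurable_snd.comp ((measurable_pi_apply n).comp measurable_snd)
  have hst : ∀ n : ℕ, Measurable fun w : Belief X × (ℕ → Fin X × ℝ) => (w.2 n).1 := fun n =>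
    measurable_fst.comp ((measurable_pi_apply n).comp measurable_snd)
  have hμ : Measurable fun w : Belief X × (ℕ → Fin X × ℝ) => μ.1 w.1 := μ.2.comp measurable_fst
  have hc : ∀ g : Fin X → ℝ≥0, ∀ n : ℕ,
      Measurable fun w : Belief X × (ℕ → Fin X × ℝ) => g (w.2 n).1 := fun g n =>
    (measurable_of_finite g).comp (hst n)
  induction k with
  | zero =>
    simp only [epochCost_zero]
    refine measurable_of_forall_action hμ (G := fun v w => if v = 0 then P.c (w.2 0).1 0 else
      P.m (w.2 0).1 v + ∑ t ∈ Finset.range (P.D v), P.c (w.2 t).1 v) fun v => ?_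
    by_cases hv : v = 0
    · simp only [hv, if_pos]
      exact hc (fun x => P.c x 0) 0
    · simp only [hv, if_neg, not_false_eq_true]
      exact (hc (fun x => P.m x v) 0).add
        (Finset.measurable_fun_sum _ fun t _ => hc (fun x => P.c x v) t)
  | succ k ih =>
    simp only [epochCost_succ]
    refine measurable_of_forall_action hμ (G := fun v w => if v = 0 then 0 else
      θ.epochCost P μ (θ.filter P w.1 (w.2 (P.D v)).2 v) (shiftPath (P.D v) w.2) k) fun v => ?_
    by_cases hv : v = 0
    · simp only [hv, if_pos]
      exact measurable_const
    · simp only [hv, if_neg, not_false_eq_true]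
      exact ih.comp (((θ.measurable_filter P v).comp (measurable_fst.prodMk (hobs _))).prodMk
        ((measurable_shiftPath _).comp measurable_snd))

/-- The measurement of the initial state is not used. -/
theorem epochCost_consPath (π : Belief X) (x : Fin X) (y z : ℝ) (ω : ℕ → Fin X × ℝ) (k : ℕ) :
    θ.epochCost P μ π (consPath (x, y) ω) k = θ.epochCost P μ π (consPath (x, z) ω) k := by
  have hst : ∀ t, (consPath (x, y) ω t).1 = (consPath (x, z) ω t).1 := by
    intro t; cases t <;> rfl
  cases k with
  | zero => simp only [epochCost_zero, hst]
  | succ k =>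
    simp only [epochCost_succ]
    by_cases h0 : μ.1 π = 0
    · simp [h0]
    -- Since `D` is positive, the next sampling time is at least `1`, and the measurement at time
    -- `0` is never read.
    · obtain ⟨d, hd⟩ := Nat.exists_eq_succ_of_ne_zero (P.D_pos _ h0).ne'
      have e : ∀ s : Fin X × ℝ, shiftPath (d + 1) (consPath s ω) = shiftPath d ω := by
        intro s
        ext1 t
        simp only [shiftPath, add_right_comm d 1 t, consPath]
      simp only [hd, Nat.succ_eq_add_one, e, consPath]

/-- The cost of the first `N` decisions along a trajectory. -/
noncomputable def truncCost (N : ℕ) (π : Belief X) (ω : ℕ → Fin X × ℝ) : ℝ≥0∞ :=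
  ∑ k ∈ Finset.range N, (θ.epochCost P μ π ω k : ℝ≥0∞)

theorem measurable_truncCost (N : ℕ) :
    Measurable fun w : Belief X × (ℕ → Fin X × ℝ) => θ.truncCost P μ N w.1 w.2 :=
  Finset.measurable_fun_sum _ fun k _ => (θ.measurable_epochCost P μ k).coe_nnreal_ennreal

theorem truncCost_succ (N : ℕ) (π : Belief X) (ω : ℕ → Fin X × ℝ) :
    θ.truncCost P μ (N + 1) π ω = (θ.epochCost P μ π ω 0 : ℝ≥0∞) + if μ.1 π = 0 then 0 else
      θ.truncCost P μ N (θ.filter P π (ω (P.D (μ.1 π))).2 (μ.1 π))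
        (shiftPath (P.D (μ.1 π)) ω) := by
  rw [truncCost, Finset.sum_range_succ', add_comm]
  congr 1
  simp only [epochCost_succ]
  split_ifs with h
  · simp
  · rfl

/-- The expected cost of the first `N` decisions if the initial state is `x` and the initial
belief is `π`. -/
noncomputable def stateCost (N : ℕ) (π : Belief X) (x : Fin X) : ℝ≥0∞ :=
  ∫⁻ ω, θ.truncCost P μ N π ω ∂θ.startLaw x

theorem measurable_stateCost (N : ℕ) (x : Fin X) :
    Measurable fun π => θ.stateCost P μ N π x :=
  (θ.measurable_truncCost P μ N).lintegral_prod_right'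

theorem pow_A_nonneg (n : ℕ) (x z : Fin X) : 0 ≤ (θ.A ^ n) x z :=
  (pow_mem θ.A_stochastic n).1 x z

theorem costVec_nonneg (u : Fin (L + 1)) : 0 ≤ θ.costVec P u := by
  intro x
  rw [costVec]
  split_ifs
  · exact NNReal.coe_nonneg _
  · refine add_nonneg (NNReal.coe_nonneg _) ?_
    simp only [Matrix.mulVec, dotProduct]
    refine Finset.sum_nonneg fun z _ => mul_nonneg ?_ (NNReal.coe_nonneg _)
    rw [Matrix.sum_apply]
    exact Finset.sum_nonneg fun l _ => θ.pow_A_nonneg l x z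

theorem costVec_of_ne_zero {u : Fin (L + 1)} (hu : u ≠ 0) (x : Fin X) :
    θ.costVec P u x = P.m x u + ∑ l ∈ Finset.range (P.D u), ∑ z, (θ.A ^ l) x z * P.c z u := by
  rw [costVec, if_neg hu]
  simp only [Pi.add_apply, Matrix.mulVec, dotProduct, Matrix.sum_apply, Finset.sum_mul]
  rw [Finset.sum_comm]

theorem lintegral_epochCost_zero (π : Belief X) (x : Fin X) :
    ∫⁻ ω, (θ.epochCost P μ π ω 0 : ℝ≥0∞) ∂θ.startLaw x =
      ENNReal.ofReal (θ.costVec P (μ.1 π) x) := by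
  simp only [epochCost_zero]
  by_cases h0 : μ.1 π = 0
  · simp only [h0, if_pos]
    rw [θ.lintegral_startLaw_state x fun z => (P.c z 0 : ℝ≥0∞)]
    simp [costVec]
  · simp only [h0, if_neg, not_false_eq_true, ENNReal.coe_add, ENNReal.ofNNReal_finsetSum]
    have hm : ∀ (g : Fin X → ℝ≥0∞) (n : ℕ),
        Measurable fun ω : ℕ → Fin X × ℝ => g (ω n).1 := fun g n =>
      (measurable_of_finite g).comp (measurable_fst.comp (measurable_pi_apply n))
    rw [lintegral_add_left (hm (fun z => (P.m z (μ.1 π) : ℝ≥0∞)) 0),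
      lintegral_finsetSum _ fun t _ => hm (fun z => (P.c z (μ.1 π) : ℝ≥0∞)) t,
      θ.lintegral_startLaw_state x fun z => (P.m z (μ.1 π) : ℝ≥0∞),
      costVec_of_ne_zero _ _ h0]
    have hnn : ∀ l z, 0 ≤ (θ.A ^ l) x z * (P.c z (μ.1 π) : ℝ) := fun l z =>
      mul_nonneg (θ.pow_A_nonneg l x z) (NNReal.coe_nonneg _)
    rw [ENNReal.ofReal_add (NNReal.coe_nonneg _)
      (Finset.sum_nonneg fun l _ => Finset.sum_nonneg fun z _ => hnn l z),
      ENNReal.ofReal_coe_nnreal,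
      ENNReal.ofReal_sum_of_nonneg fun l _ => Finset.sum_nonneg fun z _ => hnn l z]
    congr 1
    refine Finset.sum_congr rfl fun l _ => ?_
    rw [θ.lintegral_startLaw_state_at x l fun z => (P.c z (μ.1 π) : ℝ≥0∞),
      ENNReal.ofReal_sum_of_nonneg fun z _ => hnn l z]
    refine Finset.sum_congr rfl fun z _ => ?_
    rw [ENNReal.ofReal_mul (θ.pow_A_nonneg l x z), ENNReal.ofReal_coe_nnreal]

/-- State and belief are kept as separate arguments: once the state is fixed, the belief still
drives the strategy but is no longer the law of the state. -/
theorem stateCost_succ (N : ℕ) (π : Belief X) (x : Fin X) :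
    θ.stateCost P μ (N + 1) π x = ENNReal.ofReal (θ.costVec P (μ.1 π) x) +
      if μ.1 π = 0 then 0 else ∑ z, ENNReal.ofReal ((θ.A ^ P.D (μ.1 π)) x z) *
        ∫⁻ y, θ.stateCost P μ N (θ.filter P π y (μ.1 π)) z ∂θ.obsLaw z := by
  have hm0 : Measurable fun ω => (θ.epochCost P μ π ω 0 : ℝ≥0∞) :=
    ((θ.measurable_epochCost P μ 0).comp measurable_prodMk_left).coe_nnreal_ennreal
  simp only [stateCost, truncCost_succ]
  rw [lintegral_add_left hm0, lintegral_epochCost_zero]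
  congr 1
  by_cases h0 : μ.1 π = 0
  · simp [h0]
  simp only [h0, if_neg, not_false_eq_true]
  generalize μ.1 π = u
  exact θ.lintegral_startLaw_shift_obs (P.D u) x
    (Ψ := fun y ω => θ.truncCost P μ N (θ.filter P π y u) ω)
    ((θ.measurable_truncCost P μ N).comp
      ((((θ.measurable_filter P u).comp measurable_prodMk_left).comp measurable_fst).prodMk
        measurable_snd))
    fun y z y' ω => Finset.sum_congr rfl fun k _ => by rw [epochCost_consPath (y := y') (z := y)]

/-- The expected cost of the first `N` decisions. -/
noncomputable def horizonCost (N : ℕ) (π : Belief X) : ℝ≥0∞ :=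
  ∫⁻ ω, θ.truncCost P μ N π ω ∂θ.pathLaw π

theorem horizonCost_eq_sum (N : ℕ) (π : Belief X) :
    θ.horizonCost P μ N π = ∑ x, ENNReal.ofReal (π.1 x) * θ.stateCost P μ N π x :=
  θ.lintegral_pathLaw π _

theorem horizonCost_zero (π : Belief X) : θ.horizonCost P μ 0 π = 0 := by
  simp [horizonCost, truncCost]

/-- Non-negative costs allow the sum over decisions and the expectation to be exchanged. -/
theorem totalCost_eq_iSup (π : Belief X) :
    θ.totalCost P μ π = ⨆ N, θ.horizonCost P μ N π := by
  have hm : ∀ k, Measurable fun ω => (θ.epochCost P μ π ω k : ℝ≥0∞) := fun k =>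
    ((θ.measurable_epochCost P μ k).comp measurable_prodMk_left).coe_nnreal_ennreal
  rw [totalCost, lintegral_tsum fun k => (hm k).aemeasurable, ENNReal.tsum_eq_iSup_nat]
  refine iSup_congr fun N => ?_
  rw [horizonCost, ← lintegral_finsetSum _ fun k _ => hm k]
  rfl

end Epoch

/-- The right-hand side of Bellman's equation, for a general continuation cost `V`. -/
noncomputable def bellmanRHS (θ : SamplingModel X) (P : SamplingProtocol X L)
    (V : Belief X → ℝ≥0∞) (π : Belief X) (u : Fin (L + 1)) : ℝ≥0∞ :=
  if u = 0 then ENNReal.ofReal (θ.cost P π 0)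
  else ENNReal.ofReal (θ.cost P π u) +
    ∫⁻ y, V (θ.filter P π y u) * ENNReal.ofReal (θ.sigma P π y u) ∂θ.ν

theorem ofReal_cost (θ : SamplingModel X) (P : SamplingProtocol X L) (π : Belief X)
    (u : Fin (L + 1)) : ENNReal.ofReal (θ.cost P π u) =
      ∑ x, ENNReal.ofReal (π.1 x) * ENNReal.ofReal (θ.costVec P u x) := by
  rw [cost, ENNReal.ofReal_sum_of_nonneg fun x _ =>
    mul_nonneg (θ.costVec_nonneg P u x) (π.2.1 x)]
  refine Finset.sum_congr rfl fun x _ => ?_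
  rw [mul_comm, ENNReal.ofReal_mul (π.2.1 x)]

/-- Averaging `stateCost` over the state restores the belief as its law. Bayes' rule in the form
prediction times likelihood equals `σ` times posterior turns the joint average over next state and
measurement into one over the measurement alone. -/
theorem horizonCost_succ (θ : SamplingModel X) (P : SamplingProtocol X L)
    (μ : SamplingStrategy X L) (N : ℕ) (π : Belief X) :
    θ.horizonCost P μ (N + 1) π = θ.bellmanRHS P (θ.horizonCost P μ N) π (μ.1 π) := by
  rw [horizonCost_eq_sum, bellmanRHS]
  simp only [stateCost_succ, mul_add, Finset.sum_add_distrib]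
  rw [← ofReal_cost]
  by_cases h0 : μ.1 π = 0
  · simp [h0]
  simp only [h0, if_neg, not_false_eq_true]
  congr 1
  generalize μ.1 π = u
  have hK : ∀ z, Measurable fun y => θ.stateCost P μ N (θ.filter P π y u) z := fun z =>
    (θ.measurable_stateCost P μ N z).comp
      ((θ.measurable_filter P u).comp measurable_prodMk_left)
  have hpred : ∀ z, ENNReal.ofReal (θ.predict P π u z) =
      ∑ x, ENNReal.ofReal (π.1 x) * ENNReal.ofReal ((θ.A ^ P.D u) x z) := by
    intro z
    simp only [predict, Matrix.mulVec, dotProduct, Matrix.transpose_apply]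
    rw [ENNReal.ofReal_sum_of_nonneg fun x _ => mul_nonneg (θ.pow_A_nonneg _ x z) (π.2.1 x)]
    refine Finset.sum_congr rfl fun x _ => ?_
    rw [mul_comm, ENNReal.ofReal_mul (π.2.1 x)]
  simp only [Finset.mul_sum]
  rw [Finset.sum_comm]
  simp only [← mul_assoc, ← Finset.sum_mul, ← hpred, horizonCost_eq_sum]
  have hBK : ∀ z, Measurable fun y => ENNReal.ofReal (θ.B z y) *
      θ.stateCost P μ N (θ.filter P π y u) z := fun z =>
    (θ.B_measurable z).ennreal_ofReal.mul (hK z)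
  have e : ∀ z, ENNReal.ofReal (θ.predict P π u z) *
      ∫⁻ y, θ.stateCost P μ N (θ.filter P π y u) z ∂θ.obsLaw z =
      ∫⁻ y, ENNReal.ofReal (θ.predict P π u z) * (ENNReal.ofReal (θ.B z y) *
        θ.stateCost P μ N (θ.filter P π y u) z) ∂θ.ν := by
    intro z
    rw [lintegral_const_mul _ (hBK z), obsLaw,
      lintegral_withDensity_eq_lintegral_mul _ (θ.B_measurable z).ennreal_ofReal (hK z)]
    rfl
  simp only [e]
  rw [← lintegral_finsetSum _ fun z _ => (hBK z).const_mul _]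
  refine lintegral_congr fun y => ?_
  rw [Finset.sum_mul]
  refine Finset.sum_congr rfl fun z _ => ?_
  rw [← mul_assoc, ← ENNReal.ofReal_mul (θ.predict_nonneg P π u z), mul_comm (θ.predict P π u z),
    ← sigma_mul_filter, ENNReal.ofReal_mul (θ.sigma_nonneg P π y u)]
  ring

end SamplingModel

/-! ### Value iteration -/

namespace SamplingModel

variable {X L : ℕ} (θ : SamplingModel X) (P : SamplingProtocol X L)

/-- The cost of the action `u` with continuation cost `F`, as a function of the vector of
masses `p`. -/
noncomputable def actionValue (F : (Fin X → ℝ) → ℝ) (u : Fin (L + 1)) (p : Fin X → ℝ) : ℝ :=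
  if u = 0 then θ.costVec P 0 ⬝ᵥ p
  else θ.costVec P u ⬝ᵥ p + θ.observe F ((θ.A ^ P.D u)ᵀ *ᵥ p)

/-- The value functions of the finite horizon problems, on vectors of masses. -/
noncomputable def iterValue : ℕ → (Fin X → ℝ) → ℝ
  | 0 => fun _ => 0
  | n + 1 => fun p =>
    Finset.univ.inf' Finset.univ_nonempty fun u => θ.actionValue P (iterValue n) u p

theorem superlinear_actionValue {F : (Fin X → ℝ) → ℝ} (hF : Superlinear F) (u : Fin (L + 1)) :
    Superlinear (θ.actionValue P F u) := by
  unfold actionValue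
  by_cases hu : u = 0
  · simp only [hu, if_pos]
    exact Superlinear.dotProduct _
  · simp only [hu, if_neg, not_false_eq_true]
    exact (Superlinear.dotProduct _).add ((θ.superlinear_observe hF).comp_mulVec _)

theorem superlinear_iterValue (n : ℕ) : Superlinear (θ.iterValue P n) := by
  induction n with
  | zero => exact Superlinear.zero
  | succ n ih =>
    exact Superlinear.inf' Finset.univ_nonempty fun u _ => θ.superlinear_actionValue P ih u

theorem actionValue_mono {F G : (Fin X → ℝ) → ℝ} (hF : Superlinear F) (hG : Superlinear G)
    (h : ∀ p, 0 ≤ p → F p ≤ G p) (u : Fin (L + 1)) {p : Fin X → ℝ} (hp : 0 ≤ p) :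
    θ.actionValue P F u p ≤ θ.actionValue P G u p := by
  unfold actionValue
  split_ifs
  · exact le_rfl
  · exact add_le_add le_rfl (θ.observe_mono_of_le hF hG h
      (transpose_mulVec_nonneg (pow_mem θ.A_stochastic _) hp))

theorem iterValue_nonneg (n : ℕ) {p : Fin X → ℝ} (hp : 0 ≤ p) : 0 ≤ θ.iterValue P n p := by
  induction n generalizing p with
  | zero => exact le_rfl
  | succ n ih =>
    refine Finset.le_inf' Finset.univ_nonempty _ fun u _ => ?_
    have hdot : ∀ v, 0 ≤ θ.costVec P v ⬝ᵥ p := fun v =>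
      Finset.sum_nonneg fun x _ => mul_nonneg (θ.costVec_nonneg P v x) (hp x)
    unfold actionValue
    split_ifs
    · exact hdot 0
    · exact add_nonneg (hdot u) (θ.observe_nonneg (fun q hq => ih hq)
        (transpose_mulVec_nonneg (pow_mem θ.A_stochastic _) hp))

/-- Iteration starts at `0`, below every non-negative value, and each step is monotone. -/
theorem iterValue_le_succ (n : ℕ) {p : Fin X → ℝ} (hp : 0 ≤ p) :
    θ.iterValue P n p ≤ θ.iterValue P (n + 1) p := by
  induction n generalizing p with
  | zero => exact θ.iterValue_nonneg P 1 hp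
  | succ n ih =>
    refine Finset.le_inf' Finset.univ_nonempty _ fun u hu => (Finset.inf'_le _ hu).trans ?_
    exact θ.actionValue_mono P (θ.superlinear_iterValue P n) (θ.superlinear_iterValue P (n + 1))
      (fun q hq => ih hq) u hp

/-- The right-hand side of Bellman's equation in terms of vectors of masses. -/
theorem bellmanRHS_ofReal {F : (Fin X → ℝ) → ℝ} (hF : Superlinear F)
    (hF0 : ∀ p, 0 ≤ p → 0 ≤ F p) (π : Belief X) (u : Fin (L + 1)) :
    θ.bellmanRHS P (fun π' => ENNReal.ofReal (F π'.1)) π u =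
      ENNReal.ofReal (θ.actionValue P F u π.1) := by
  unfold bellmanRHS actionValue
  split_ifs
  · rfl
  have hpred : 0 ≤ θ.predict P π u := θ.predict_nonneg P π u
  change _ = ENNReal.ofReal (θ.cost P π u + θ.observe F (θ.predict P π u))
  have hcost : 0 ≤ θ.cost P π u :=
    Finset.sum_nonneg fun x _ => mul_nonneg (θ.costVec_nonneg P u x) (π.2.1 x)
  rw [ENNReal.ofReal_add hcost (θ.observe_nonneg hF0 hpred)]
  congr 1
  unfold observe
  rw [ofReal_integral_eq_lintegral_ofReal (θ.integrable_comp_weigh hF _)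
    (Filter.Eventually.of_forall fun y => hF0 _ (θ.weigh_nonneg hpred y))]
  refine lintegral_congr fun y => ?_
  -- Homogeneity absorbs `σ`, also where it vanishes and the filter has its default value.
  have e : θ.weigh (θ.predict P π u) y = θ.sigma P π y u • (θ.filter P π y u).1 := by
    ext x
    exact (θ.sigma_mul_filter P π y u x).symm
  rw [e, hF.homog _ _ (θ.sigma_nonneg P π y u), mul_comm,
    ENNReal.ofReal_mul (θ.sigma_nonneg P π y u)]

theorem bellmanRHS_mono {V W : Belief X → ℝ≥0∞} (h : ∀ π, V π ≤ W π) (π : Belief X)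
    (u : Fin (L + 1)) : θ.bellmanRHS P V π u ≤ θ.bellmanRHS P W π u := by
  unfold bellmanRHS
  split_ifs
  · exact le_rfl
  · gcongr
    exact h _

/-- The limit of value iteration. -/
noncomputable def limitValue (π : Belief X) : ℝ≥0∞ := ⨆ n, ENNReal.ofReal (θ.iterValue P n π.1)

theorem monotone_ofReal_iterValue (π : Belief X) :
    Monotone fun n => ENNReal.ofReal (θ.iterValue P n π.1) :=
  monotone_nat_of_le_succ fun n => ENNReal.ofReal_le_ofReal (θ.iterValue_le_succ P n π.2.1)

theorem bellmanRHS_limitValue (π : Belief X) (u : Fin (L + 1)) :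
    θ.bellmanRHS P (θ.limitValue P) π u =
      ⨆ n, ENNReal.ofReal (θ.actionValue P (θ.iterValue P n) u π.1) := by
  simp only [← bellmanRHS_ofReal θ P (θ.superlinear_iterValue P _)
    (fun p hp => θ.iterValue_nonneg P _ hp)]
  unfold bellmanRHS
  split_ifs
  · exact (ciSup_const).symm
  rw [← ENNReal.add_iSup]
  congr 1
  rw [← lintegral_iSup]
  · refine lintegral_congr fun y => ?_
    rw [limitValue, ENNReal.iSup_mul]
  · intro n
    refine Measurable.mul ?_ ((θ.measurable_sigma P u).comp measurable_prodMk_left).ennreal_ofReal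
    exact ((θ.superlinear_iterValue P n).continuous.measurable.comp (measurable_subtype_coe.comp
      ((θ.measurable_filter P u).comp measurable_prodMk_left))).ennreal_ofReal
  · intro n k hnk y
    exact mul_le_mul' (θ.monotone_ofReal_iterValue P _ hnk) le_rfl

theorem measurable_bellmanRHS_limitValue (u : Fin (L + 1)) :
    Measurable fun π => θ.bellmanRHS P (θ.limitValue P) π u := by
  simp only [bellmanRHS_limitValue]
  exact Measurable.iSup fun n => ((θ.superlinear_actionValue P (θ.superlinear_iterValue P n)
    u).continuous.measurable.comp measurable_subtype_coe).ennreal_ofReal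

theorem measurable_limitValue : Measurable (θ.limitValue P) :=
  Measurable.iSup fun n => ((θ.superlinear_iterValue P n).continuous.measurable.comp
    measurable_subtype_coe).ennreal_ofReal

/-- Finiteness of the action set exchanges minimum and supremum: if every action exceeded the limit
at some stage `n u`, then at the largest of these stages the minimising action would exceed it too.
-/
theorem exists_bellmanRHS_limitValue_le (π : Belief X) :
    ∃ u, θ.bellmanRHS P (θ.limitValue P) π u ≤ θ.limitValue P π := by
  by_contra! h
  simp only [bellmanRHS_limitValue, lt_iSup_iff] at h
  choose n hn using h
  obtain ⟨u, -, hu⟩ := Finset.exists_mem_eq_inf' (Finset.univ_nonempty (α := Fin (L + 1)))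
    fun u => θ.actionValue P (θ.iterValue P (Finset.univ.sup n)) u π.1
  have h1 : ENNReal.ofReal (θ.actionValue P (θ.iterValue P (n u)) u π.1) ≤
      ENNReal.ofReal (θ.actionValue P (θ.iterValue P (Finset.univ.sup n)) u π.1) := by
    refine ENNReal.ofReal_le_ofReal (θ.actionValue_mono P (θ.superlinear_iterValue P _)
      (θ.superlinear_iterValue P _) (fun p hp => ?_) u π.2.1)
    exact monotone_nat_of_le_succ (f := fun k => θ.iterValue P k p)
      (fun k => θ.iterValue_le_succ P k hp) (Finset.le_sup (Finset.mem_univ u))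
  have h2 : ENNReal.ofReal (θ.iterValue P (Finset.univ.sup n + 1) π.1) ≤ θ.limitValue P π :=
    le_iSup (fun k => ENNReal.ofReal (θ.iterValue P k π.1)) _
  simp only [iterValue, hu] at h2
  exact absurd ((hn u).trans_le (h1.trans h2)) (lt_irrefl _)

/-- Ties are broken by the smallest index, which keeps the choice measurable. -/
theorem exists_measurable_selection {α : Type*} [MeasurableSpace α] {S : Fin (L + 1) → Set α}
    (hS : ∀ u, MeasurableSet (S u)) (hcov : ∀ a, ∃ u, a ∈ S u) :
    ∃ f : α → Fin (L + 1), Measurable f ∧ ∀ a, a ∈ S (f a) := by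
  classical
  have hex : ∀ a, ∃ n : ℕ, ∃ h : n < L + 1, a ∈ S ⟨n, h⟩ := fun a => by
    obtain ⟨u, hu⟩ := hcov a
    exact ⟨u, u.2, hu⟩
  have hlt : ∀ a, Nat.find (hex a) < L + 1 := fun a => (Nat.find_spec (hex a)).1
  have hmeas : Measurable fun a => Nat.find (hex a) := by
    refine measurable_find _ fun n => ?_
    by_cases h : n < L + 1
    · simpa [h] using hS ⟨n, h⟩
    · simp [h]
  refine ⟨fun a => ⟨Nat.find (hex a), hlt a⟩, ?_, fun a => (Nat.find_spec (hex a)).2⟩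
  refine measurable_to_countable' fun u => ?_
  have e : (fun a => (⟨Nat.find (hex a), hlt a⟩ : Fin (L + 1))) ⁻¹' {u} =
      (fun a => Nat.find (hex a)) ⁻¹' {(u : ℕ)} := by
    ext a
    simp [Fin.ext_iff]
  rw [e]
  exact hmeas (measurableSet_singleton _)

/-- No strategy does better than value iteration. -/
theorem limitValue_le_totalCost (μ : SamplingStrategy X L) (π : Belief X) :
    θ.limitValue P π ≤ θ.totalCost P μ π := by
  rw [totalCost_eq_iSup]
  refine iSup_mono fun n => ?_
  induction n generalizing π with
  | zero => simp [iterValue]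
  | succ n ih =>
    rw [horizonCost_succ]
    refine le_trans ?_ (θ.bellmanRHS_mono P ih π (μ.1 π))
    rw [bellmanRHS_ofReal θ P (θ.superlinear_iterValue P n)
      (fun p hp => θ.iterValue_nonneg P n hp)]
    exact ENNReal.ofReal_le_ofReal (Finset.inf'_le _ (Finset.mem_univ _))

/-- A strategy which is greedy for the limit of value iteration attains it. -/
theorem exists_totalCost_le_limitValue :
    ∃ μ : SamplingStrategy X L, ∀ π, θ.totalCost P μ π ≤ θ.limitValue P π := by
  obtain ⟨f, hf, hgreedy⟩ := exists_measurable_selection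
    (S := fun u => {π | θ.bellmanRHS P (θ.limitValue P) π u ≤ θ.limitValue P π})
    (fun u => measurableSet_le (θ.measurable_bellmanRHS_limitValue P u)
      (θ.measurable_limitValue P)) (θ.exists_bellmanRHS_limitValue_le P)
  refine ⟨⟨f, hf⟩, fun π => ?_⟩
  rw [totalCost_eq_iSup]
  refine iSup_le fun n => ?_
  induction n generalizing π with
  | zero => simp [horizonCost_zero]
  | succ n ih =>
    rw [horizonCost_succ]
    exact (θ.bellmanRHS_mono P ih π (f π)).trans (hgreedy π)

theorem optimalCost_eq_limitValue (π : Belief X) :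
    θ.optimalCost P π = θ.limitValue P π := by
  obtain ⟨μ, hμ⟩ := θ.exists_totalCost_le_limitValue P
  exact le_antisymm ((iInf_le _ μ).trans (hμ π))
    (le_iInf fun μ' => θ.limitValue_le_totalCost P μ' π)

/-- Every sampling problem has an optimal stationary strategy. -/
theorem exists_isOptimal : ∃ μ, θ.IsOptimal P μ := by
  obtain ⟨μ, hμ⟩ := θ.exists_totalCost_le_limitValue P
  refine ⟨μ, fun π => ?_⟩
  rw [optimalCost_eq_limitValue]
  exact le_antisymm (hμ π) (θ.limitValue_le_totalCost P μ π)

/-! ### Comparison of two models -/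

theorem lrMonotone_iterValue (hC : ∀ u, Monotone (θ.costVec P u)) (hA : IsTP2 θ.A)
    (hB : IsTP2 θ.B) (n : ℕ) : LRMonotone (θ.iterValue P n) := by
  induction n with
  | zero => intro p q _ _ _; simp [iterValue]
  | succ n ih =>
    refine LRMonotone.inf' Finset.univ_nonempty fun u _ => ?_
    unfold actionValue
    by_cases hu : u = 0
    · simp only [hu, if_pos]
      exact lrMonotone_dotProduct (hC 0)
    · simp only [hu, if_neg, not_false_eq_true]
      exact (lrMonotone_dotProduct (hC u)).add
        ((θ.lrMonotone_observe hB (θ.superlinear_iterValue P n) ih).comp_transpose_pow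
          θ.A_stochastic hA _)

variable {θ P}

theorem sum_pow_mul_le {θ' : SamplingModel X} (hA : TransitionDominates θ.A θ'.A)
    (htp : IsTP2 θ.A) {c : Fin X → ℝ} (hc : Monotone c) (l : ℕ) (x : Fin X) :
    ∑ z, (θ'.A ^ l) x z * c z ≤ ∑ z, (θ.A ^ l) x z * c z := by
  -- Row `x` of a power of the matrix is the prediction from the point mass at `x`.
  have h0 : (0 : Fin X → ℝ) ≤ Pi.single x 1 := Pi.single_nonneg.2 zero_le_one
  have h := LRLe.transpose_pow_of_transitionDominates θ.A_stochastic θ'.A_stochastic hA htp h0 l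
  have h1 := (lrMonotone_dotProduct hc).le_of_sum_eq
    (transpose_mulVec_nonneg (pow_mem θ.A_stochastic l) h0)
    (transpose_mulVec_nonneg (pow_mem θ'.A_stochastic l) h0) h
    ((sum_transpose_mulVec (pow_mem θ'.A_stochastic l) _).trans
      (sum_transpose_mulVec (pow_mem θ.A_stochastic l) _).symm)
  simpa [dotProduct, mul_comm, ← Matrix.transpose_pow] using h1

/-- The comparison is made time point by time point, so it rests on monotonicity of `c` itself;
monotonicity of `costVec` serves the value functions instead. -/
theorem costVec_le_of_transitionDominates {θ' : SamplingModel X}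
    (hA : TransitionDominates θ.A θ'.A) (htp : IsTP2 θ.A)
    (hc : ∀ u, Monotone fun i => P.c i u) (u : Fin (L + 1)) (x : Fin X) :
    θ'.costVec P u x ≤ θ.costVec P u x := by
  by_cases hu : u = 0
  · simp [costVec, hu]
  · rw [costVec_of_ne_zero _ _ hu, costVec_of_ne_zero _ _ hu]
    refine add_le_add le_rfl (Finset.sum_le_sum fun l _ => ?_)
    exact sum_pow_mul_le hA htp (c := fun z => (P.c z u : ℝ))
      (fun i j hij => NNReal.coe_le_coe.2 (hc u hij)) l x

/-- The better transition matrix and the less accurate measurements lead to larger values. -/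
theorem iterValue_le_iterValue {θ' : SamplingModel X} (hA : TransitionDominates θ.A θ'.A)
    (hR : ReverseBlackwell θ θ') (hC : ∀ u, Monotone (θ.costVec P u))
    (hc : ∀ u, Monotone fun i => P.c i u) (htp : IsTP2 θ.A) (hB : IsTP2 θ.B) (n : ℕ)
    {p : Fin X → ℝ} (hp : 0 ≤ p) : θ'.iterValue P n p ≤ θ.iterValue P n p := by
  induction n generalizing p with
  | zero => exact le_rfl
  | succ n ih =>
    refine Finset.le_inf' Finset.univ_nonempty _ fun u hu => (Finset.inf'_le _ hu).trans ?_
    have hdot : ∀ v, θ'.costVec P v ⬝ᵥ p ≤ θ.costVec P v ⬝ᵥ p := fun v =>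
      Finset.sum_le_sum fun x _ => mul_le_mul_of_nonneg_right
        (costVec_le_of_transitionDominates hA htp hc v x) (hp x)
    unfold actionValue
    split_ifs
    · exact hdot 0
    refine add_le_add (hdot u) ?_
    have hq := transpose_mulVec_nonneg (pow_mem θ.A_stochastic (P.D u)) hp
    have hq' := transpose_mulVec_nonneg (pow_mem θ'.A_stochastic (P.D u)) hp
    have hF := θ.superlinear_iterValue P n
    -- The continuation value, the measurement and the prediction are exchanged one at a time. After
    -- the first exchange only the value function of `θ` occurs, which is both concave and monotone
    -- in the likelihood ratio order.
    calc θ'.observe (θ'.iterValue P n) ((θ'.A ^ P.D u)ᵀ *ᵥ p)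
        ≤ θ'.observe (θ.iterValue P n) ((θ'.A ^ P.D u)ᵀ *ᵥ p) :=
          θ'.observe_mono_of_le (θ'.superlinear_iterValue P n) hF (fun r hr => ih hr) hq'
      _ ≤ θ.observe (θ.iterValue P n) ((θ'.A ^ P.D u)ᵀ *ᵥ p) :=
          observe_le_of_reverseBlackwell hR hF _
      _ ≤ θ.observe (θ.iterValue P n) ((θ.A ^ P.D u)ᵀ *ᵥ p) :=
          (θ.lrMonotone_observe hB hF (θ.lrMonotone_iterValue P hC htp hB n)).le_of_sum_eq hq hq'
            (LRLe.transpose_pow_of_transitionDominates θ.A_stochastic θ'.A_stochastic hA htp hp _)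
            ((sum_transpose_mulVec (pow_mem θ'.A_stochastic _) _).trans
              (sum_transpose_mulVec (pow_mem θ.A_stochastic _) _).symm)

end SamplingModel

theorem theorem6 {X L : ℕ} [NeZero X] (P : SamplingProtocol X L) (θ θ' : SamplingModel X)
    (hA : TransitionDominates θ.A θ'.A)
    (hB : SamplingModel.ReverseBlackwell θ θ')
    (hC : ∀ u, Monotone (θ.costVec P u))
    (hc : ∀ u, Monotone fun i => P.c i u)
    (hS : stdSimplex.vertex (S := ℝ) (0 : Fin X) ∈ θ.stoppingSet P)
    (hA_tp2 : IsTP2 θ.A)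
    (hB_tp2 : IsTP2 θ.B) :
    (∃ μ, θ.IsOptimal P μ) ∧ (∃ μ', θ'.IsOptimal P μ') ∧
      ∀ μ μ', θ.IsOptimal P μ → θ'.IsOptimal P μ' →
        ∀ π, θ'.totalCost P μ' π ≤ θ.totalCost P μ π := by
  refine ⟨θ.exists_isOptimal P, θ'.exists_isOptimal P, fun μ μ' hμ hμ' π => ?_⟩
  rw [hμ π, hμ' π, SamplingModel.optimalCost_eq_limitValue,
    SamplingModel.optimalCost_eq_limitValue]
  exact iSup_mono fun n => ENNReal.ofReal_le_ofReal
    (SamplingModel.iterValue_le_iterValue hA hB hC hc hA_tp2 hB_tp2 n π.2.1)
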